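/- **Setting.** A group-server queue has Poisson arrivals of rate $\lambda>0$ and $K$ server groups; group $k$ has $M_k$ exponential servers, each with service rate $\mu_k>0$ and operating cost rate $c_k\ge 0$. Different groups are heterogeneous: $(\mu_k,c_k)\ne(\mu_l,c_l)$ for $k\neq l$. The holding cost rate $h(n)$ in state $n$ (the number of customers) is increasing and convex in $n$, with $h(n)\to\infty$. An (efficient, stationary) policy $d$ assigns to each $n\in\mathbb N$ numbers $d(n,k)\in\{0,\dots,M_k\}$ of working servers with $\sum_k d(n,k)\le n$. Under $d$ the number of customers $n_t$ is the continuous-time birth-death chain with birth rate $\lambda$ and death rate $\sum_k d(n,k)\mu_k$ in state $n$, and costs accrue at rate $f(n,d(n))=h(n)+\sum_k d(n,k)c_k$. The long-run average cost is $$\eta^d=\lim_{T\to\infty}\frac1T\,\mathbb E\Big[\int_0^T f(n_t,d(n_t))\,dt \,\Big|\, n_0=n\Big]$$ (finite if this is a finite limit, the same for every initial state $n$). A policy is optimal if $\eta^d$ is finite and $\eta^d\le\eta^{d'}$ for every policy $d'$ with finite $\eta^{d'}$. A performance potential of a policy $d$ of finite average cost is a function $g$ with $g(n)=\mathbb E[\int_0^\infty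 (f(n_t,d(n_t))-\eta^d)\,dt\mid n_0=n]$ up to an additive constant, i.e. for all $n$ $$g(n)-g(0)=\lim_{T\to\infty}\Big(\mathbb E\Big[\int_0^T (f-\eta^d)\,dt\,\Big|\,n_0=n\Big]-\mathbb E\Big[\int_0^T (f-\eta^d)\,dt\,\Big|\,n_0=0\Big]\Big),$$ and $G(n)=g(n)-g(n-1)$, $n\ge1$, is its perturbation realization factor. (For $n=0$ all $d(0,k)$ are $0$ and the value of $G(0)$, set to $0$, is irrelevant.) **Theorem ($c/\mu$-rule).** Assume scale economies: the groups are numbered so that $\frac{c_1}{\mu_1}\le\dots\le\frac{c_K}{\mu_K}$, and then $\mu_1\ge\dots\ge\mu_K$. Let $d^*$ be a policy. 1. $d^*$ is optimal if and only if it has a performance potential, with perturbation realization factor $G^*$, and for all $n\in\mathbb N$ and $k=1,\dots,K$: $$G^*(n)>\tfrac{c_k}{\mu_k}\ \Rightarrow\ d^*(n,k)=M_k\wedge\Big(n-\sum_{l=1}^{k-1}d^*(n,l)\Big),\qquad G^*(n)<\tfrac{c_k}{\mu_k}\ \Rightarrow\ d^*(n,k)=0 .$$ 2. Suppose that $d^*$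 has a performance potential and keeps indifferent servers off, i.e. $d^*(n,k)=0$ whenever $G^*(n)=\frac{c_k}{\mu_k}$. Then $d^*$ is optimal if and only if for all $n\in\mathbb N$, $k=1,\dots,K$: $d^*(n,k)=M_k\wedge\big(n-\sum_{l=1}^{k-1}d^*(n,l)\big)$ if $G^*(n)>\frac{c_k}{\mu_k}$, and $d^*(n,k)=0$ otherwise. So groups with smaller $c/\mu$ are switched on first, in an order that does not depend on the state. -/

import Mathlib

/-- The data of a group-server queue with `K` server groups: Poisson arrivals of rate `lam`;
group `k` has `M k` exponential servers, each of service rate `mu k` and operating cost rate `c k`;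
`h n` is the holding cost rate when `n` customers are present. -/
structure GroupServerQueue (K : ℕ) where
  lam : ℝ
  M : Fin K → ℕ
  mu : Fin K → ℝ
  c : Fin K → ℝ
  h : ℕ → ℝ
  lam_pos : 0 < lam
  mu_pos : ∀ k, 0 < mu k
  c_nonneg : ∀ k, 0 ≤ c k
  /-- Distinct groups are heterogeneous: they differ in service rate or in cost rate. -/
  heterogeneous : ∀ k l, k ≠ l → mu k ≠ mu l ∨ c k ≠ c l
  /-- The holding cost is increasing, convex, and tends to infinity. -/
  h_mono : Monotone h
  h_convex : ∀ n, 2 * h (n + 1) ≤ h n + h (n + 2)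
  h_tendsto : Filter.Tendsto h Filter.atTop Filter.atTop

namespace GroupServerQueue

variable {K : ℕ} (Q : GroupServerQueue K)

/-- Efficient stationary policies: `d n k` is the number of working servers of group `k` in
state `n`; at most `M k` of them exist, and no more servers work than there are customers. -/
def IsEfficient (d : ℕ → Fin K → ℕ) : Prop :=
  ∀ n, (∀ k, d n k ≤ Q.M k) ∧ ∑ k, d n k ≤ n

/-- Total service rate in state `n`. -/
noncomputable def rate (d : ℕ → Fin K → ℕ) (n : ℕ) : ℝ :=
  ∑ k, (d n k : ℝ) * Q.mu k

/-- Total cost rate `f(n, d(n))` in state `n`: holding cost plus operating cost. -/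
noncomputable def cost (d : ℕ → Fin K → ℕ) (n : ℕ) : ℝ :=
  Q.h n + ∑ k, (d n k : ℝ) * Q.c k

/-- The infinitesimal generator `B` of the number of customers under `d` (a birth-death process).
An efficient policy has `rate d 0 = 0`, so that the rows sum to zero. -/
noncomputable def gen (d : ℕ → Fin K → ℕ) (n m : ℕ) : ℝ :=
  if m = n + 1 then Q.lam
  else if m + 1 = n then Q.rate d n
  else if m = n then -(Q.lam + Q.rate d n)
  else 0

/-- The bound `Λ = λ + ∑ M_k μ_k` of all jump rates. -/
noncomputable def unifRate : ℝ :=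
  Q.lam + ∑ k, (Q.M k : ℝ) * Q.mu k

/-- The `j`-step transition probabilities of the uniformized jump chain, i.e. the entries of the
power `(I + B / Λ) ^ j`. (The sum over `i` has at most three nonzero terms.) -/
noncomputable def jumpProb (d : ℕ → Fin K → ℕ) : ℕ → ℕ → ℕ → ℝ
  | 0, n, m => if n = m then 1 else 0
  | j + 1, n, m =>
      ∑' i, ((if n = i then 1 else 0) + Q.gen d n i / Q.unifRate) * jumpProb d j i m

/-- The transition probabilities `P(n_t = m | n_0 = n)` of the continuous-time Markov chain with
generator `B`: the entries of `exp (t B) = ∑ⱼ e^{-Λ t} (Λ t)^j / j! (I + B / Λ)^j`. -/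
noncomputable def transProb (d : ℕ → Fin K → ℕ) (t : ℝ) (n m : ℕ) : ℝ :=
  ∑' j : ℕ, Real.exp (-(Q.unifRate * t)) * (Q.unifRate * t) ^ j / (j.factorial : ℝ)
    * Q.jumpProb d j n m

/-- `E[f(n_t, d(n_t)) | n_0 = n]`. -/
noncomputable def expCost (d : ℕ → Fin K → ℕ) (t : ℝ) (n : ℕ) : ℝ :=
  ∑' m, Q.transProb d t n m * Q.cost d m

/-- The long-run average cost of `d` is the (finite) number `eta`: from every initial state `n`
the expected costs are finite and `(1/T) E[∫₀ᵀ f(n_t, d(n_t)) dt | n_0 = n] → eta`. -/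
def HasAverageCost (d : ℕ → Fin K → ℕ) (eta : ℝ) : Prop :=
  ∀ n,
    (∀ t, 0 ≤ t → Summable fun m => Q.transProb d t n m * Q.cost d m) ∧
    (∀ T, 0 ≤ T → IntervalIntegrable (fun t => Q.expCost d t n) MeasureTheory.volume 0 T) ∧
    Filter.Tendsto (fun T : ℝ => (1 / T) * ∫ t in (0 : ℝ)..T, Q.expCost d t n)
      Filter.atTop (nhds eta)

/-- `d` is an (efficient) policy of minimal long-run average cost. A policy without a finite
average cost (average cost `+∞`) is not optimal and never competes. -/
def IsOptimal (d : ℕ → Fin K → ℕ) : Prop :=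
  Q.IsEfficient d ∧ ∃ eta, Q.HasAverageCost d eta ∧
    ∀ d' eta', Q.IsEfficient d' → Q.HasAverageCost d' eta' → eta ≤ eta'

/-- `g` is a performance potential (relative value function, bias) of `d`:
`g(n) = E[∫₀^∞ (f(n_t, d(n_t)) - eta) dt | n_0 = n]` up to an additive constant. The constant is
removed before the limit `T → ∞` is taken, so that the notion makes sense for every policy of
finite average cost; if the integrals over `[0, ∞)` converge, they form such a `g`. -/
def IsPotential (d : ℕ → Fin K → ℕ) (g : ℕ → ℝ) : Prop :=
  ∃ eta, Q.HasAverageCost d eta ∧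
    ∀ n, Filter.Tendsto
      (fun T : ℝ => (∫ t in (0 : ℝ)..T, (Q.expCost d t n - eta))
        - ∫ t in (0 : ℝ)..T, (Q.expCost d t 0 - eta))
      Filter.atTop (nhds (g n - g 0))

/-- Groups are numbered by increasing `c_k / μ_k`, and then the `μ_k` are non-increasing. -/
def ScaleEconomies : Prop :=
  Monotone (fun k => Q.c k / Q.mu k) ∧ Antitone Q.mu

end GroupServerQueue

/-- The perturbation realization factor `G(n) = g(n) - g(n-1)`, `n ≥ 1` (and `0` at `n = 0`, where
its value is irrelevant because no server can work). -/
def prf (g : ℕ → ℝ) (n : ℕ) : ℝ :=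
  g n - g (n - 1)

open Filter Topology

/-- The tridiagonal operator with diagonal `a`, constant upper diagonal `p` and lower
diagonal `q` (the entry `q 0` is only meaningful when it vanishes). -/
def triStep (a : ℕ → ℝ) (p : ℝ) (q : ℕ → ℝ) : (ℕ → ℝ) →ₗ[ℝ] (ℕ → ℝ) where
  toFun u n := a n * u n + p * u (n + 1) + q n * u (n - 1)
  map_add' u v := by ext n; simp only [Pi.add_apply]; ring
  map_smul' c u := by ext n; simp only [Pi.smul_apply, smul_eq_mul, RingHom.id_apply]; ring

section triStep

variable {a : ℕ → ℝ} {p : ℝ} {q : ℕ → ℝ}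

theorem triStep_apply (u : ℕ → ℝ) (n : ℕ) :
    triStep a p q u n = a n * u n + p * u (n + 1) + q n * u (n - 1) := rfl

theorem triStep_pow_succ (j : ℕ) (u : ℕ → ℝ) (n : ℕ) :
    (triStep a p q ^ (j + 1)) u n = a n * (triStep a p q ^ j) u n
      + p * (triStep a p q ^ j) u (n + 1) + q n * (triStep a p q ^ j) u (n - 1) := by
  rw [pow_succ', Module.End.mul_apply, triStep_apply]

theorem triStep_pow_nonneg (ha : ∀ n, 0 ≤ a n) (hp : 0 ≤ p) (hq : ∀ n, 0 ≤ q n) (j : ℕ)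
    {u : ℕ → ℝ} (hu : ∀ n, 0 ≤ u n) (n : ℕ) : 0 ≤ (triStep a p q ^ j) u n := by
  induction j generalizing n with
  | zero => exact hu n
  | succ j ih =>
    rw [triStep_pow_succ]
    have := mul_nonneg (ha n) (ih n)
    have := mul_nonneg hp (ih (n + 1))
    have := mul_nonneg (hq n) (ih (n - 1))
    positivity

theorem triStep_pow_congr (j : ℕ) {u v : ℕ → ℝ} (n : ℕ) (h : ∀ m ≤ n + j, u m = v m) :
    (triStep a p q ^ j) u n = (triStep a p q ^ j) v n := by
  induction j generalizing n with
  | zero => exact h n le_rfl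
  | succ j ih =>
    rw [triStep_pow_succ, triStep_pow_succ, ih n fun m hm => h m (by omega),
      ih (n + 1) fun m hm => h m (by omega), ih (n - 1) fun m hm => h m (by omega)]

/-- Expansion of the `j`-th power along its kernel. -/
theorem triStep_pow_eq_sum (j : ℕ) (u : ℕ → ℝ) (n N : ℕ) (hN : n + j < N) :
    (triStep a p q ^ j) u n
      = ∑ m ∈ Finset.range N, (triStep a p q ^ j) (Pi.single m 1) n * u m := by
  have h : (triStep a p q ^ j) u n
      = (triStep a p q ^ j) (∑ m ∈ Finset.range N, u m • Pi.single m (1 : ℝ)) n := by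
    apply triStep_pow_congr
    intro m hm
    rw [Finset.sum_apply, Finset.sum_eq_single m]
    · simp
    · intro b _ hb
      simp [hb.symm]
    · intro hm'
      exact absurd (Finset.mem_range.2 (by omega)) hm'
  rw [h, map_sum, Finset.sum_apply]
  refine Finset.sum_congr rfl fun m _ => ?_
  rw [map_smul, Pi.smul_apply, smul_eq_mul, mul_comm]

theorem triStep_pow_single_eq_zero (j n m : ℕ) (h : n + j < m) :
    (triStep a p q ^ j) (Pi.single m 1) n = 0 := by
  rw [triStep_pow_congr (v := 0) j n, map_zero, Pi.zero_apply]
  intro i hi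
  rw [Pi.single_eq_of_ne (by omega), Pi.zero_apply]

theorem triStep_single_zero (hq : q 0 = 0) : triStep a p q (Pi.single 0 1)
    = a 0 • Pi.single 0 (1 : ℝ) + q 1 • Pi.single 1 (1 : ℝ) := by
  ext n
  rw [triStep_apply]
  rcases n with _ | _ | n <;> simp [hq]

theorem triStep_single_succ (m : ℕ) : triStep a p q (Pi.single (m + 1) 1)
    = a (m + 1) • Pi.single (m + 1) (1 : ℝ) + p • Pi.single m (1 : ℝ)
      + q (m + 2) • Pi.single (m + 2) (1 : ℝ) := by
  ext n
  rw [triStep_apply]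
  simp only [Pi.add_apply, Pi.smul_apply, Pi.single_apply, smul_eq_mul, mul_ite, mul_one, mul_zero]
  have h1 : n + 1 = m + 1 ↔ n = m := by omega
  have h2 : n - 1 = m + 1 ↔ n = m + 2 := by omega
  simp only [h1, h2]
  split_ifs <;> simp_all

/-- A tridiagonal operator is symmetric with respect to weights in detailed balance. -/
theorem triStep_pow_symm (hq : q 0 = 0) {w : ℕ → ℝ}
    (hw : ∀ n, p * w n = q (n + 1) * w (n + 1)) (j n m : ℕ) :
    w n * (triStep a p q ^ j) (Pi.single m 1) n
      = w m * (triStep a p q ^ j) (Pi.single n 1) m := by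
  induction j generalizing n m with
  | zero =>
    simp only [pow_zero, Module.End.one_apply, Pi.single_apply]
    by_cases h : n = m
    · simp [h]
    · simp [h, Ne.symm h]
  | succ j ih =>
    rw [triStep_pow_succ, pow_succ, Module.End.mul_apply]
    rcases n with _ | n
    · rw [triStep_single_zero hq]
      simp only [map_add, map_smul, Pi.add_apply, Pi.smul_apply, smul_eq_mul]
      have h0 := ih 0 m
      have h1 := ih 1 m
      have hw0 := hw 0
      simp only [zero_add, hq] at *
      linear_combination a 0 * h0 + q 1 * h1 + (triStep a p q ^ j) (Pi.single m 1) 1 * hw0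
    · rw [triStep_single_succ]
      simp only [map_add, map_smul, Pi.add_apply, Pi.smul_apply, smul_eq_mul,
        Nat.add_sub_cancel]
      have h0 := ih n m
      have h1 := ih (n + 1) m
      have h2 := ih (n + 2) m
      have hw0 := hw n
      have hw1 := hw (n + 1)
      simp only [add_assoc, Nat.reduceAdd] at *
      linear_combination a (n + 1) * h1 + q (n + 2) * h2 + p * h0
        + (triStep a p q ^ j) (Pi.single m 1) (n + 2) * hw1
        - (triStep a p q ^ j) (Pi.single m 1) n * hw0

end triStep

/-- A random walk on `ℕ` with constant up-probability `p` and down-probabilities `q n`. -/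
structure BirthDeathWalk where
  p : ℝ
  q : ℕ → ℝ
  p_pos : 0 < p
  q_nonneg : ∀ n, 0 ≤ q n
  q_zero : q 0 = 0
  add_le_one : ∀ n, p + q n ≤ 1

namespace BirthDeathWalk

variable (W : BirthDeathWalk)

/-- The transition operator. -/
def trans : (ℕ → ℝ) →ₗ[ℝ] (ℕ → ℝ) := triStep (fun n => 1 - W.p - W.q n) W.p W.q

/-- The operator induced by `trans` on increments. -/
def dual : (ℕ → ℝ) →ₗ[ℝ] (ℕ → ℝ) := triStep (fun n => 1 - W.p - W.q (n + 1)) W.p W.q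

theorem trans_pow_nonneg (j : ℕ) {u : ℕ → ℝ} (hu : ∀ n, 0 ≤ u n) (n : ℕ) :
    0 ≤ (W.trans ^ j) u n :=
  triStep_pow_nonneg (fun n => by linarith [W.add_le_one n]) W.p_pos.le W.q_nonneg j hu n

theorem dual_pow_nonneg (j : ℕ) {u : ℕ → ℝ} (hu : ∀ n, 0 ≤ u n) (n : ℕ) :
    0 ≤ (W.dual ^ j) u n :=
  triStep_pow_nonneg (fun n => by linarith [W.add_le_one (n + 1)]) W.p_pos.le W.q_nonneg j hu n

theorem trans_apply (u : ℕ → ℝ) (n : ℕ) : W.trans u n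
    = u n + W.p * (u (n + 1) - u n) - W.q n * (u n - u (n - 1)) := by
  rw [trans, triStep_apply]; ring

theorem trans_pow_succ (j : ℕ) (u : ℕ → ℝ) (n : ℕ) : (W.trans ^ (j + 1)) u n
    = (W.trans ^ j) u n + W.p * ((W.trans ^ j) u (n + 1) - (W.trans ^ j) u n)
      - W.q n * ((W.trans ^ j) u n - (W.trans ^ j) u (n - 1)) := by
  rw [pow_succ', Module.End.mul_apply, trans_apply]

theorem trans_pow_const (j : ℕ) (b : ℝ) (n : ℕ) : (W.trans ^ j) (fun _ => b) n = b := by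
  induction j generalizing n with
  | zero => rfl
  | succ j ih => rw [trans_pow_succ, ih, ih, ih]; ring

theorem trans_pow_mono (j : ℕ) {u v : ℕ → ℝ} (h : ∀ n, u n ≤ v n) (n : ℕ) :
    (W.trans ^ j) u n ≤ (W.trans ^ j) v n := by
  have := W.trans_pow_nonneg j (u := v - u) (fun n => sub_nonneg.2 (h n)) n
  rw [map_sub, Pi.sub_apply] at this
  linarith

theorem trans_pow_succ_sub (j : ℕ) (u : ℕ → ℝ) (n : ℕ) :
    (W.trans ^ j) u (n + 1) - (W.trans ^ j) u n
      = (W.dual ^ j) (fun m => u (m + 1) - u m) n := by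
  induction j generalizing n with
  | zero => rfl
  | succ j ih =>
    have hd : (W.dual ^ (j + 1)) (fun m => u (m + 1) - u m) n = _ :=
      triStep_pow_succ j _ n
    change _ = (1 - W.p - W.q (n + 1)) * (W.dual ^ j) _ n + W.p * (W.dual ^ j) _ (n + 1)
      + W.q n * (W.dual ^ j) _ (n - 1) at hd
    rw [hd, trans_pow_succ, trans_pow_succ, ← ih, ← ih]
    rcases n with _ | n
    · simp only [W.q_zero]; ring_nf
    · simp only [Nat.add_sub_cancel]; rw [← ih]; ring

/-- A summable positive measure in detailed balance with the walk, of total mass one. -/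
structure IsReversible (w : ℕ → ℝ) : Prop where
  pos : ∀ n, 0 < w n
  hasSum : HasSum w 1
  balance : ∀ n, W.p * w n = W.q (n + 1) * w (n + 1)

/-- Increments of the solution of the Poisson equation with right-hand side `f - η`. -/
noncomputable def poissonInc (w f : ℕ → ℝ) (η : ℝ) (n : ℕ) : ℝ :=
  (∑ i ∈ Finset.range (n + 1), w i * (η - f i)) / (W.p * w n)

variable {W} {w f : ℕ → ℝ} {η : ℝ}

theorem IsReversible.poissonInc_zero (hw : W.IsReversible w) :
    W.p * W.poissonInc w f η 0 = η - f 0 := by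
  have h0 := (hw.pos 0).ne'
  have hp := W.p_pos.ne'
  simp only [poissonInc, zero_add, Finset.range_one, Finset.sum_singleton]
  field_simp

theorem IsReversible.poissonInc_succ (hw : W.IsReversible w) (n : ℕ) :
    W.p * W.poissonInc w f η (n + 1) - W.q (n + 1) * W.poissonInc w f η n = η - f (n + 1) := by
  have h0 := (hw.pos n).ne'
  have h1 := (hw.pos (n + 1)).ne'
  have hp := W.p_pos.ne'
  have hq : W.q (n + 1) = W.p * w n / w (n + 1) := by
    rw [eq_div_iff h1]; exact (hw.balance n).symm
  simp only [poissonInc, hq]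
  rw [Finset.sum_range_succ _ (n + 1)]
  field_simp
  ring

theorem IsReversible.poissonInc_eq (hw : W.IsReversible w) (n : ℕ) :
    W.p * W.poissonInc w f η n - W.q n * W.poissonInc w f η (n - 1) = η - f n := by
  rcases n with _ | n
  · rw [W.q_zero, hw.poissonInc_zero]; ring
  · exact hw.poissonInc_succ n

theorem IsReversible.dual_poissonInc (hw : W.IsReversible w) :
    W.dual (W.poissonInc w f η) = W.poissonInc w f η - fun n => f (n + 1) - f n := by
  ext n
  have h1 := hw.poissonInc_eq (f := f) (η := η) n
  have h2 := hw.poissonInc_succ (f := f) (η := η) n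
  rw [dual, triStep_apply, Pi.sub_apply]
  linarith

theorem dual_pow_single_sum_le (n j N : ℕ) :
    ∑ m ∈ Finset.range N, (W.dual ^ j) (Pi.single n 1) m ≤ 1 := by
  set u : ℕ → ℝ := fun m => if n < m then 1 else 0 with hu
  have h : (fun m => u (m + 1) - u m) = Pi.single n (1 : ℝ) := by
    ext m
    simp only [hu, Pi.single_apply]
    split_ifs <;> first | omega | simp
  rw [← h]
  simp only [← trans_pow_succ_sub]
  rw [Finset.sum_range_sub (fun m => (W.trans ^ j) u m)]
  have h1 := W.trans_pow_mono j (u := u) (v := fun _ => 1)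
    (fun n => by simp only [hu]; split_ifs <;> norm_num) N
  have h2 := W.trans_pow_nonneg j (u := u)
    (fun n => by simp only [hu]; split_ifs <;> norm_num) 0
  rw [trans_pow_const] at h1
  linarith

theorem IsReversible.sum_dual_pow (hw : W.IsReversible w) (j : ℕ) :
    ∑ i ∈ Finset.range j, (W.dual ^ i) (fun n => f (n + 1) - f n)
      = W.poissonInc w f η - (W.dual ^ j) (W.poissonInc w f η) := by
  induction j with
  | zero => simp
  | succ j ih =>
    rw [Finset.sum_range_succ, ih, pow_succ, Module.End.mul_apply, hw.dual_poissonInc, map_sub]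
    abel

/-- The increments chain is transient. -/
theorem IsReversible.tendsto_dual_pow_single (hw : W.IsReversible w) (n m : ℕ) :
    Tendsto (fun j => (W.dual ^ j) (Pi.single n 1) m) atTop (𝓝 0) := by
  set u : ℕ → ℝ := fun m => if n < m then 1 else 0 with hu
  have h : (fun m => u (m + 1) - u m) = Pi.single n (1 : ℝ) := by
    ext m
    simp only [hu, Pi.single_apply]
    split_ifs <;> first | omega | simp
  set C : ℝ := 1 - ∑ i ∈ Finset.range (n + 1), w i with hC
  have hle : ∀ N, ∑ i ∈ Finset.range N, w i ≤ 1 := fun N =>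
    sum_le_hasSum _ (fun i _ => (hw.pos i).le) hw.hasSum
  have hG : ∀ m, 0 ≤ W.poissonInc w u C m := by
    intro m
    refine div_nonneg ?_ (mul_nonneg W.p_pos.le (hw.pos m).le)
    have hC0 : 0 ≤ C := by linarith [hle (n + 1)]
    rcases le_or_gt m n with hmn | hmn
    · refine Finset.sum_nonneg fun i hi => mul_nonneg (hw.pos i).le ?_
      rw [Finset.mem_range] at hi
      simp only [hu]
      rw [if_neg (by omega)]
      linarith
    · have hs : ∑ i ∈ Finset.range (m + 1), w i * u i
          = ∑ i ∈ Finset.range (m + 1), w i - ∑ i ∈ Finset.range (n + 1), w i := by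
        rw [← Finset.sum_range_add_sum_Ico w (show n + 1 ≤ m + 1 by omega),
          ← Finset.sum_range_add_sum_Ico (fun i => w i * u i) (show n + 1 ≤ m + 1 by omega)]
        rw [Finset.sum_eq_zero, Finset.sum_congr rfl (g := w)]
        · ring
        · intro i hi
          rw [Finset.mem_Ico] at hi
          simp only [hu]
          rw [if_pos (by omega), mul_one]
        · intro i hi
          rw [Finset.mem_range] at hi
          simp only [hu]
          rw [if_neg (by omega), mul_zero]
      simp only [mul_sub, Finset.sum_sub_distrib]
      rw [hs, ← Finset.sum_mul]
      have h1 := hle (m + 1)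
      have h2 : 0 ≤ ∑ i ∈ Finset.range (n + 1), w i :=
        Finset.sum_nonneg fun i _ => (hw.pos i).le
      have h3 := mul_nonneg h2 (sub_nonneg.2 h1)
      rw [hC]
      nlinarith
  have hsum : Summable fun j => (W.dual ^ j) (Pi.single n 1) m := by
    refine summable_of_sum_range_le (c := W.poissonInc w u C m) (fun j => ?_) (fun j => ?_)
    · refine W.dual_pow_nonneg j (fun i => ?_) m
      rw [Pi.single_apply]; split_ifs <;> norm_num
    · have := congrFun (hw.sum_dual_pow (f := u) (η := C) j) m
      rw [h, Finset.sum_apply, Pi.sub_apply] at this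
      rw [this]
      linarith [W.dual_pow_nonneg j hG m]
  exact hsum.tendsto_atTop_zero

/-- Weighted averages of a null sequence whose weights are substochastic and vanish pointwise. -/
theorem tendsto_sum_mul_of_tendsto_zero {k : ℕ → ℕ → ℝ} {s : ℕ → ℝ} {N : ℕ → ℕ}
    (hk0 : ∀ j n, 0 ≤ k j n) (hk1 : ∀ j M, ∑ n ∈ Finset.range M, k j n ≤ 1)
    (hk : ∀ n, Tendsto (fun j => k j n) atTop (𝓝 0)) (hs : Tendsto s atTop (𝓝 0)) :
    Tendsto (fun j => ∑ n ∈ Finset.range (N j), k j n * s n) atTop (𝓝 0) := by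
  rw [Metric.tendsto_atTop]
  intro ε hε
  obtain ⟨M, hM⟩ := Metric.tendsto_atTop.1 hs (ε / 2) (by positivity)
  have hfin : Tendsto (fun j => ∑ n ∈ Finset.range M, k j n * |s n|) atTop (𝓝 0) := by
    have := tendsto_finsetSum (Finset.range M) fun n _ => (hk n).mul_const |s n|
    simpa using this
  obtain ⟨J, hJ⟩ := Metric.tendsto_atTop.1 hfin (ε / 2) (by positivity)
  refine ⟨J, fun j hj => ?_⟩
  have h1 := hJ j hj
  rw [Real.dist_eq, sub_zero] at h1 ⊢
  have h1' := lt_of_le_of_lt (le_abs_self _) h1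
  have hle : ∀ n ∈ Finset.range (N j),
      |k j n * s n| ≤ (if n < M then k j n * |s n| else 0) + k j n * (ε / 2) := by
    intro n _
    rw [abs_mul, abs_of_nonneg (hk0 j n)]
    split_ifs with h
    · have := mul_nonneg (hk0 j n) (half_pos hε).le
      linarith
    · have := hM n (not_lt.1 h)
      rw [Real.dist_eq, sub_zero] at this
      rw [zero_add]
      exact mul_le_mul_of_nonneg_left this.le (hk0 j n)
  calc |∑ n ∈ Finset.range (N j), k j n * s n|
      ≤ ∑ n ∈ Finset.range (N j), |k j n * s n| := Finset.abs_sum_le_sum_abs _ _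
    _ ≤ _ := Finset.sum_le_sum hle
    _ = ∑ n ∈ Finset.range (N j) with n < M, k j n * |s n|
        + (∑ n ∈ Finset.range (N j), k j n) * (ε / 2) := by
      rw [Finset.sum_add_distrib, Finset.sum_mul, Finset.sum_filter]
    _ ≤ ∑ n ∈ Finset.range M, k j n * |s n| + 1 * (ε / 2) := by
      refine add_le_add (Finset.sum_le_sum_of_subset_of_nonneg (fun n hn => ?_) fun n _ _ =>
        mul_nonneg (hk0 j n) (abs_nonneg _)) (mul_le_mul_of_nonneg_right (hk1 j _) (half_pos hε).le)
      exact Finset.mem_range.2 (Finset.mem_filter.1 hn).2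
    _ < ε := by linarith

theorem IsReversible.tendsto_dual_pow_poissonInc (hw : W.IsReversible w)
    (hf : HasSum (fun n => w n * f n) η) (m : ℕ) :
    Tendsto (fun j => (W.dual ^ j) (W.poissonInc w f η) m) atTop (𝓝 0) := by
  set s : ℕ → ℝ := fun n => ∑ i ∈ Finset.range (n + 1), w i * (η - f i) with hsdef
  have hs : Tendsto s atTop (𝓝 0) := by
    have h1 : HasSum (fun n => w n * (η - f n)) 0 := by
      have := (hw.hasSum.mul_right η).sub hf
      simpa [mul_sub] using this
    exact (h1.tendsto_sum_nat).comp (tendsto_add_atTop_nat 1)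
  have key : ∀ j, (W.dual ^ j) (W.poissonInc w f η) m
      = (∑ n ∈ Finset.range (m + j + 1), (W.dual ^ j) (Pi.single m 1) n * s n)
        * (W.p * w m)⁻¹ := by
    intro j
    rw [dual, triStep_pow_eq_sum j _ m (m + j + 1) (by omega), Finset.sum_mul]
    refine Finset.sum_congr rfl fun n _ => ?_
    have hsymm := triStep_pow_symm (a := fun n => 1 - W.p - W.q (n + 1)) W.q_zero hw.balance j m n
    have hn := (hw.pos n).ne'
    have hm := (hw.pos m).ne'
    have hp := W.p_pos.ne'
    rw [poissonInc]
    field_simp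
    linear_combination s n * hsymm
  have hlim := tendsto_sum_mul_of_tendsto_zero (s := s) (N := fun j => m + j + 1)
    (k := fun j n => (W.dual ^ j) (Pi.single m 1) n)
    (fun j n => W.dual_pow_nonneg j (fun i => by rw [Pi.single_apply]; split_ifs <;> norm_num) n)
    (fun j M => dual_pow_single_sum_le m j M)
    (fun n => hw.tendsto_dual_pow_single m n) hs
  simp only [key]
  simpa using hlim.mul_const (W.p * w m)⁻¹

/-- The solution of the Poisson equation vanishing at `0`. -/
noncomputable def poissonSol (W : BirthDeathWalk) (w f : ℕ → ℝ) (η : ℝ) (n : ℕ) : ℝ :=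
  ∑ i ∈ Finset.range n, W.poissonInc w f η i

theorem poissonSol_succ_sub (n : ℕ) :
    W.poissonSol w f η (n + 1) - W.poissonSol w f η n = W.poissonInc w f η n := by
  rw [poissonSol, Finset.sum_range_succ, poissonSol]; ring

theorem IsReversible.trans_poissonSol (hw : W.IsReversible w) :
    W.trans (W.poissonSol w f η) = W.poissonSol w f η + ((fun _ => η) - f) := by
  ext n
  rw [trans_apply, poissonSol_succ_sub]
  have h := hw.poissonInc_eq (f := f) (η := η) n
  simp only [Pi.add_apply, Pi.sub_apply]
  rcases n with _ | n
  · rw [W.q_zero] at h ⊢; linarith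
  · rw [Nat.add_sub_cancel] at h ⊢; rw [poissonSol_succ_sub]; linarith

theorem IsReversible.trans_pow_succ_poissonSol (hw : W.IsReversible w) (j n : ℕ) :
    (W.trans ^ (j + 1)) (W.poissonSol w f η) n
      = (W.trans ^ j) (W.poissonSol w f η) n + (η - (W.trans ^ j) f n) := by
  rw [pow_succ, Module.End.mul_apply, hw.trans_poissonSol, map_add, map_sub, Pi.add_apply,
    Pi.sub_apply, trans_pow_const]

theorem IsReversible.tendsto_trans_pow_poissonSol (hw : W.IsReversible w)
    (hf : HasSum (fun n => w n * f n) η) (n : ℕ) :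
    Tendsto (fun j => (W.trans ^ j) (W.poissonSol w f η) n - (W.trans ^ j) (W.poissonSol w f η) 0)
      atTop (𝓝 0) := by
  have h : ∀ j, (W.trans ^ j) (W.poissonSol w f η) n - (W.trans ^ j) (W.poissonSol w f η) 0
      = ∑ i ∈ Finset.range n, (W.dual ^ j) (W.poissonInc w f η) i := by
    intro j
    rw [← Finset.sum_range_sub (fun m => (W.trans ^ j) (W.poissonSol w f η) m)]
    refine Finset.sum_congr rfl fun i _ => ?_
    rw [trans_pow_succ_sub]
    simp only [poissonSol_succ_sub]
  simp only [h]
  simpa using tendsto_finsetSum (Finset.range n) fun i _ => hw.tendsto_dual_pow_poissonInc hf i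

/-- Ergodic theorem for possibly unbounded functions. -/
theorem IsReversible.tendsto_trans_pow (hw : W.IsReversible w)
    (hf : HasSum (fun n => w n * f n) η) (n : ℕ) :
    Tendsto (fun j => (W.trans ^ j) f n) atTop (𝓝 η) := by
  set g := W.poissonSol w f η
  have h : ∀ j, (W.trans ^ j) f n = η
      - (W.p * (((W.trans ^ j) g (n + 1) - (W.trans ^ j) g 0)
          - ((W.trans ^ j) g n - (W.trans ^ j) g 0))
        - W.q n * (((W.trans ^ j) g n - (W.trans ^ j) g 0)
          - ((W.trans ^ j) g (n - 1) - (W.trans ^ j) g 0))) := by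
    intro j
    have h1 := hw.trans_pow_succ_poissonSol (f := f) (η := η) j n
    have h2 := W.trans_pow_succ j g n
    linarith
  have hl := hw.tendsto_trans_pow_poissonSol hf
  have := tendsto_const_nhds (x := η) |>.sub
    ((((hl (n + 1)).sub (hl n)).const_mul W.p).sub
      (((hl n).sub (hl (n - 1))).const_mul (W.q n)))
  simp only [sub_zero, mul_zero] at this
  simp only [h]
  exact this

end BirthDeathWalk

/-- The mixture of the sequence `x` over a Poisson law of mean `s`. -/
noncomputable def poissonMix (x : ℕ → ℝ) (s : ℝ) : ℝ :=
  ∑' j : ℕ, Real.exp (-s) * s ^ j / (j.factorial : ℝ) * x j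

/-- All Poisson mixtures of `x` converge. -/
def PoissonSummable (x : ℕ → ℝ) : Prop :=
  ∀ s : ℝ, 0 ≤ s → Summable fun j : ℕ => Real.exp (-s) * s ^ j / (j.factorial : ℝ) * x j

theorem poissonMix_zero (x : ℕ → ℝ) : poissonMix x 0 = x 0 := by
  rw [poissonMix, tsum_eq_single 0]
  · simp
  · intro j hj
    simp [hj]

theorem poissonSummable_of_bounded {x : ℕ → ℝ} {C : ℝ} (h : ∀ j, |x j| ≤ C) :
    PoissonSummable x := by
  intro s hs
  have h1 : Summable fun j : ℕ => C * Real.exp (-s) * (s ^ j / (j.factorial : ℝ)) :=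
    (Real.summable_pow_div_factorial s).mul_left _
  refine Summable.of_norm_bounded h1 fun j => ?_
  rw [Real.norm_eq_abs, abs_mul, abs_of_nonneg (by positivity)]
  calc Real.exp (-s) * s ^ j / (j.factorial : ℝ) * |x j|
      ≤ Real.exp (-s) * s ^ j / (j.factorial : ℝ) * C :=
        mul_le_mul_of_nonneg_left (h j) (by positivity)
    _ = _ := by ring

theorem PoissonSummable.const (b : ℝ) : PoissonSummable fun _ => b :=
  poissonSummable_of_bounded (C := |b|) fun _ => le_rfl

theorem PoissonSummable.add {x y : ℕ → ℝ} (hx : PoissonSummable x) (hy : PoissonSummable y) :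
    PoissonSummable fun j => x j + y j := fun s hs => by
  simpa only [mul_add] using (hx s hs).add (hy s hs)

theorem PoissonSummable.sub {x y : ℕ → ℝ} (hx : PoissonSummable x) (hy : PoissonSummable y) :
    PoissonSummable fun j => x j - y j := fun s hs => by
  simpa only [mul_sub] using (hx s hs).sub (hy s hs)

theorem PoissonSummable.const_mul {x : ℕ → ℝ} (hx : PoissonSummable x) (b : ℝ) :
    PoissonSummable fun j => b * x j := fun s hs => by
  simpa only [mul_left_comm] using (hx s hs).mul_left b

theorem poissonMix_sub {x y : ℕ → ℝ} (hx : PoissonSummable x) (hy : PoissonSummable y)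
    {s : ℝ} (hs : 0 ≤ s) :
    poissonMix (fun j => x j - y j) s = poissonMix x s - poissonMix y s := by
  rw [poissonMix, poissonMix, poissonMix, ← (hx s hs).tsum_sub (hy s hs)]
  simp only [mul_sub]

theorem poissonMix_add {x y : ℕ → ℝ} (hx : PoissonSummable x) (hy : PoissonSummable y)
    {s : ℝ} (hs : 0 ≤ s) :
    poissonMix (fun j => x j + y j) s = poissonMix x s + poissonMix y s := by
  rw [poissonMix, poissonMix, poissonMix, ← (hx s hs).tsum_add (hy s hs)]
  simp only [mul_add]

theorem poissonMix_const_mul (x : ℕ → ℝ) (b s : ℝ) :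
    poissonMix (fun j => b * x j) s = b * poissonMix x s := by
  rw [poissonMix, poissonMix, ← tsum_mul_left]
  simp only [mul_left_comm]

theorem poissonMix_const (b s : ℝ) : poissonMix (fun _ => b) s = b := by
  have h : HasSum (fun j : ℕ => s ^ j / (j.factorial : ℝ)) (Real.exp s) := by
    rw [Real.exp_eq_exp_ℝ]; exact NormedSpace.expSeries_div_hasSum_exp s
  have h2 : HasSum (fun j : ℕ => Real.exp (-s) * s ^ j / (j.factorial : ℝ) * b) b := by
    have := h.mul_left (Real.exp (-s) * b)
    rw [mul_right_comm, ← Real.exp_add, neg_add_cancel, Real.exp_zero, one_mul] at this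
    exact (funext fun j => by ring : (fun j : ℕ => Real.exp (-s) * b * (s ^ j / (j.factorial : ℝ)))
      = fun j : ℕ => Real.exp (-s) * s ^ j / (j.factorial : ℝ) * b) ▸ this
  exact h2.tsum_eq

theorem poissonMix_nonneg {x : ℕ → ℝ} (hx : ∀ j, 0 ≤ x j) {s : ℝ} (hs : 0 ≤ s) :
    0 ≤ poissonMix x s :=
  tsum_nonneg fun j => mul_nonneg (by positivity) (hx j)

theorem PoissonSummable.summable_abs {x : ℕ → ℝ} (hx : PoissonSummable x) {s : ℝ} (hs : 0 ≤ s) :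
    Summable fun j : ℕ => |x j| * s ^ j / (j.factorial : ℝ) := by
  have h := (hx s hs).abs.mul_left (Real.exp s)
  refine h.congr fun j => ?_
  rw [abs_mul, abs_of_nonneg (by positivity)]
  have : Real.exp s * Real.exp (-s) = 1 := by rw [← Real.exp_add]; simp
  linear_combination (s ^ j / (j.factorial : ℝ) * |x j|) * this

theorem PoissonSummable.summable_abs_succ {x : ℕ → ℝ} (hx : PoissonSummable x) {s : ℝ}
    (hs : 0 < s) : Summable fun j : ℕ => |x (j + 1)| * s ^ j / (j.factorial : ℝ) := by
  have h := ((summable_nat_add_iff 1).2 (hx.summable_abs (s := 2 * s) (by positivity))).mul_left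
      s⁻¹
  refine Summable.of_nonneg_of_le (fun j => by positivity) (fun j => ?_) h
  have h2 : ((j : ℝ) + 1) ≤ 2 ^ (j + 1) := by
    exact_mod_cast (Nat.lt_two_pow_self (n := j + 1)).le
  have hfac : ((j + 1).factorial : ℝ) = (j + 1) * (j.factorial : ℝ) := by
    rw [Nat.factorial_succ]; push_cast; ring
  have hf : (0 : ℝ) < (j.factorial : ℝ) := by positivity
  rw [hfac, mul_pow, pow_succ s]
  rw [show s⁻¹ * (|x (j + 1)| * (2 ^ (j + 1) * (s ^ j * s)) / ((j + 1) * (j.factorial : ℝ)))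
    = |x (j + 1)| * s ^ j / (j.factorial : ℝ) * (2 ^ (j + 1) / (j + 1)) by field_simp]
  refine le_mul_of_one_le_right (by positivity) ?_
  rw [le_div_iff₀ (by positivity)]
  linarith

/-- Derivative of an exponential generating function. -/
theorem PoissonSummable.hasDerivAt_egf {x : ℕ → ℝ} (hx : PoissonSummable x) (s : ℝ) :
    HasDerivAt (fun s : ℝ => ∑' j : ℕ, x j * s ^ j / (j.factorial : ℝ))
      (∑' j : ℕ, x (j + 1) * s ^ j / (j.factorial : ℝ)) s := by
  set R : ℝ := |s| + 1 with hR
  have hR0 : 0 < R := by positivity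
  have hu := hx.summable_abs_succ hR0
  have hdiv : ∀ j : ℕ, ((j : ℝ) + 1) / ((j + 1).factorial : ℝ) = 1 / (j.factorial : ℝ) := by
    intro j
    rw [Nat.factorial_succ]; push_cast; field_simp
  set g' : ℕ → ℝ → ℝ := fun j y => x j * (j * y ^ (j - 1)) / (j.factorial : ℝ) with hg'
  have hg'succ : ∀ j y, g' (j + 1) y = x (j + 1) * y ^ j / (j.factorial : ℝ) := by
    intro j y
    simp only [hg', Nat.add_sub_cancel]
    push_cast
    linear_combination (x (j + 1) * y ^ j) * hdiv j
  set u : ℕ → ℝ := fun j => |g' j R| with hudef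
  have hus : Summable u := by
    rw [← summable_nat_add_iff 1]
    refine hu.congr fun j => ?_
    simp only [hudef, hg'succ]
    rw [abs_div, abs_mul, abs_of_pos (pow_pos hR0 j), Nat.abs_cast]
  have hder := hasDerivAt_tsum_of_isPreconnected (𝕜 := ℝ)
    (g := fun (j : ℕ) (y : ℝ) => x j * y ^ j / (j.factorial : ℝ)) (g' := g') (u := u)
    (t := Metric.ball 0 R) (y₀ := 0) (y := s) hus Metric.isOpen_ball
    (convex_ball _ _).isPreconnected
    (fun j y _ => ((hasDerivAt_pow j y).const_mul (x j)).div_const _)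
    (fun j y hy => ?_) (Metric.mem_ball_self hR0) ?_ ?_
  · rw [show ∑' j, g' j s = ∑' j : ℕ, x (j + 1) * s ^ j / (j.factorial : ℝ) by
      have hs0 : Summable fun j => g' j s := by
        rw [← summable_nat_add_iff 1]
        refine Summable.of_norm_bounded hu fun j => ?_
        rw [hg'succ, Real.norm_eq_abs, abs_div, abs_mul, abs_pow, Nat.abs_cast]
        gcongr
        linarith
      rw [hs0.tsum_eq_zero_add]
      simp only [hg'succ]
      simp [hg']] at hder
    exact hder
  · rw [Metric.mem_ball, dist_zero_right, Real.norm_eq_abs] at hy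
    simp only [hudef, hg', Real.norm_eq_abs, abs_div, abs_mul, abs_pow, abs_of_pos hR0]
    gcongr
  · exact summable_of_ne_finset_zero (s := {0}) fun j hj => by
      simp only [Finset.mem_singleton] at hj
      simp [hj]
  · rw [Metric.mem_ball, dist_zero_right, Real.norm_eq_abs]; linarith

theorem poissonMix_eq_exp_mul (x : ℕ → ℝ) (s : ℝ) :
    poissonMix x s = Real.exp (-s) * ∑' j : ℕ, x j * s ^ j / (j.factorial : ℝ) := by
  rw [poissonMix, ← tsum_mul_left]
  exact tsum_congr fun j => by ring

theorem PoissonSummable.hasDerivAt {x : ℕ → ℝ} (hx : PoissonSummable x) (s : ℝ) :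
    HasDerivAt (poissonMix x) (poissonMix (fun j => x (j + 1)) s - poissonMix x s) s := by
  have h := ((Real.hasDerivAt_exp (-s)).comp s (hasDerivAt_neg s)).mul (hx.hasDerivAt_egf s)
  have hfun : poissonMix x = (Real.exp ∘ Neg.neg)
      * fun s : ℝ => ∑' j : ℕ, x j * s ^ j / (j.factorial : ℝ) := by
    ext y; rw [poissonMix_eq_exp_mul]; rfl
  rw [hfun]
  refine h.congr_deriv ?_
  rw [← hfun, poissonMix_eq_exp_mul, poissonMix_eq_exp_mul]
  simp only [Function.comp]
  ring

theorem PoissonSummable.continuous {x : ℕ → ℝ} (hx : PoissonSummable x) :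
    Continuous (poissonMix x) :=
  continuous_iff_continuousAt.2 fun s => (hx.hasDerivAt s).continuousAt

theorem PoissonSummable.succ {x : ℕ → ℝ} (hx : PoissonSummable x) :
    PoissonSummable fun j => x (j + 1) := by
  intro s hs
  rcases hs.eq_or_lt with rfl | hs
  · refine summable_of_ne_finset_zero (s := {0}) fun j hj => ?_
    simp only [Finset.mem_singleton] at hj
    simp [hj]
  refine Summable.of_norm (((hx.summable_abs_succ hs).mul_left (Real.exp (-s))).congr fun j => ?_)
  rw [Real.norm_eq_abs, abs_mul,
    abs_of_nonneg (show 0 ≤ Real.exp (-s) * s ^ j / (j.factorial : ℝ) by positivity)]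
  ring

/-- Poisson mixtures of a convergent sequence converge as the mean tends to infinity. -/
theorem tendsto_poissonMix {x : ℕ → ℝ} {L : ℝ} (hx : Tendsto x atTop (𝓝 L)) :
    PoissonSummable x ∧ Tendsto (poissonMix x) atTop (𝓝 L) := by
  obtain ⟨C, hC⟩ := (Metric.isBounded_range_of_tendsto x hx).exists_norm_le
  have hC' : ∀ j, |x j| ≤ C := fun j => hC _ (Set.mem_range_self j)
  have hsx := poissonSummable_of_bounded hC'
  refine ⟨hsx, ?_⟩
  rw [Metric.tendsto_atTop]
  intro ε hε
  obtain ⟨N, hN⟩ := Metric.tendsto_atTop.1 hx (ε / 2) (by positivity)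
  have hfin : Tendsto (fun s : ℝ => ∑ j ∈ Finset.range N,
      Real.exp (-s) * s ^ j / (j.factorial : ℝ) * |x j - L|) atTop (𝓝 0) := by
    have := tendsto_finsetSum (Finset.range N) fun (j : ℕ) _ =>
      ((Real.tendsto_pow_mul_exp_neg_atTop_nhds_zero j).div_const (j.factorial : ℝ)).mul_const
        |x j - L|
    simpa [mul_comm] using this
  obtain ⟨S, hS⟩ := Metric.tendsto_atTop.1 hfin (ε / 2) (by positivity)
  refine ⟨max S 0, fun s hs => ?_⟩
  have hs0 : 0 ≤ s := (le_max_right _ _).trans hs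
  have h1 := hS s ((le_max_left _ _).trans hs)
  rw [Real.dist_eq, sub_zero] at h1
  have h1' := lt_of_le_of_lt (le_abs_self _) h1
  set y : ℕ → ℝ := fun j => if j < N then |x j - L| else 0 with hy
  have hysupp : ∀ j ∉ Finset.range N, Real.exp (-s) * s ^ j / (j.factorial : ℝ) * y j = 0 := by
    intro j hj
    rw [Finset.mem_range] at hj
    simp [hy, hj]
  have hysum : PoissonSummable y := by
    refine poissonSummable_of_bounded (C := C + |L|) fun j => ?_
    simp only [hy]
    split_ifs
    · rw [abs_abs]; exact (abs_sub _ _).trans (by linarith [hC' j])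
    · rw [abs_zero]; linarith [hC' j, abs_nonneg (x j), abs_nonneg L]
  have hyval : poissonMix y s
      = ∑ j ∈ Finset.range N, Real.exp (-s) * s ^ j / (j.factorial : ℝ) * |x j - L| := by
    rw [poissonMix, tsum_eq_sum hysupp]
    refine Finset.sum_congr rfl fun j hj => ?_
    simp only [hy]; rw [if_pos (Finset.mem_range.1 hj)]
  have hle : ∀ j, |x j - L| ≤ y j + ε / 2 := by
    intro j
    simp only [hy]
    split_ifs with h
    · linarith
    · have := hN j (not_lt.1 h)
      rw [Real.dist_eq] at this
      linarith
  have hsub := poissonMix_sub hsx (PoissonSummable.const L) hs0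
  have hadd := poissonMix_add hysum (PoissonSummable.const (ε / 2)) hs0
  rw [poissonMix_const] at hsub hadd
  have hup := poissonMix_nonneg (x := fun j => (y j + ε / 2) - (x j - L))
    (fun j => by linarith [hle j, le_abs_self (x j - L)]) hs0
  have hlo := poissonMix_nonneg (x := fun j => (y j + ε / 2) + (x j - L))
    (fun j => by linarith [hle j, neg_abs_le (x j - L)]) hs0
  rw [poissonMix_sub (hysum.add (.const _)) (hsx.sub (.const _)) hs0] at hup
  rw [poissonMix_add (hysum.add (.const _)) (hsx.sub (.const _)) hs0] at hlo
  rw [Real.dist_eq, abs_lt]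
  constructor <;> linarith

/-- Time averages of a convergent function converge. -/
theorem tendsto_average_of_tendsto {u : ℝ → ℝ} {L : ℝ}
    (hi : ∀ T, 0 ≤ T → IntervalIntegrable u MeasureTheory.volume 0 T)
    (hu : Tendsto u atTop (𝓝 L)) :
    Tendsto (fun T : ℝ => (1 / T) * ∫ t in (0 : ℝ)..T, u t) atTop (𝓝 L) := by
  rw [Metric.tendsto_atTop]
  intro ε hε
  obtain ⟨S, hS⟩ := Metric.tendsto_atTop.1 hu (ε / 2) (by positivity)
  set S' := max S 0
  have hS0 : 0 ≤ S' := le_max_right _ _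
  set A := |(∫ t in (0 : ℝ)..S', u t) - S' * L| with hA
  refine ⟨max S' (2 * A / ε) + 1, fun T hT => ?_⟩
  have hTS : S' < T := by linarith [le_max_left S' (2 * A / ε)]
  have hTA : 2 * A / ε < T := by linarith [le_max_right S' (2 * A / ε)]
  have hT0 : 0 < T := by linarith
  have hInt : IntervalIntegrable u MeasureTheory.volume S' T :=
    (hi S' hS0).symm.trans (hi T hT0.le)
  have hsplit := intervalIntegral.integral_add_adjacent_intervals (hi S' hS0) hInt
  have hb : |∫ t in S'..T, (u t - L)| ≤ ε / 2 * |T - S'| := by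
    rw [← Real.norm_eq_abs]
    refine intervalIntegral.norm_integral_le_of_norm_le_const fun t ht => ?_
    rw [Set.uIoc_of_le hTS.le] at ht
    have := hS t ((le_max_left S 0).trans ht.1.le)
    rw [Real.dist_eq] at this
    exact this.le
  rw [intervalIntegral.integral_sub hInt intervalIntegrable_const, intervalIntegral.integral_const,
    smul_eq_mul, abs_of_pos (by linarith : 0 < T - S')] at hb
  have hA2 : A < ε / 2 * T := by
    rw [div_lt_iff₀ hε] at hTA; linarith
  rw [Real.dist_eq]
  have e : 1 / T * (∫ t in (0 : ℝ)..T, u t) - L = (1 / T) * ((∫ t in (0 : ℝ)..T, u t) - T * L) := by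
    field_simp
  rw [e, abs_mul, abs_of_pos (by positivity : 0 < 1 / T), one_div, inv_mul_lt_iff₀ hT0, ← hsplit]
  have h3 : |(∫ t in (0 : ℝ)..S', u t) + (∫ t in S'..T, u t) - T * L| ≤ A
      + |(∫ t in S'..T, u t) - (T - S') * L| := by
    rw [hA]
    refine le_trans (le_of_eq ?_) (abs_add_le _ _)
    congr 1; ring
  have h4 : ε / 2 * (T - S') ≤ ε / 2 * T := by nlinarith
  nlinarith

namespace GroupServerQueue

variable {K : ℕ} {Q : GroupServerQueue K} {d : ℕ → Fin K → ℕ}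

theorem rate_nonneg (Q : GroupServerQueue K) (d : ℕ → Fin K → ℕ) (n : ℕ) : 0 ≤ Q.rate d n :=
  Finset.sum_nonneg fun k _ => mul_nonneg (Nat.cast_nonneg _) (Q.mu_pos k).le

theorem unifRate_pos (Q : GroupServerQueue K) : 0 < Q.unifRate :=
  add_pos_of_pos_of_nonneg Q.lam_pos <|
    Finset.sum_nonneg fun k _ => mul_nonneg (Nat.cast_nonneg _) (Q.mu_pos k).le

theorem IsEfficient.rate_le (hd : Q.IsEfficient d) (n : ℕ) :
    Q.rate d n ≤ ∑ k, (Q.M k : ℝ) * Q.mu k :=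
  Finset.sum_le_sum fun k _ =>
    mul_le_mul_of_nonneg_right (Nat.cast_le.2 ((hd n).1 k)) (Q.mu_pos k).le

theorem IsEfficient.zero (hd : Q.IsEfficient d) (k : Fin K) : d 0 k = 0 :=
  Finset.sum_eq_zero_iff.1 (Nat.le_zero.1 (hd 0).2) k (Finset.mem_univ k)

theorem IsEfficient.rate_zero (hd : Q.IsEfficient d) : Q.rate d 0 = 0 :=
  Finset.sum_eq_zero fun k _ => by rw [hd.zero k]; simp

theorem h_le_cost (Q : GroupServerQueue K) (d : ℕ → Fin K → ℕ) (n : ℕ) : Q.h n ≤ Q.cost d n :=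
  le_add_of_nonneg_right <|
    Finset.sum_nonneg fun k _ => mul_nonneg (Nat.cast_nonneg _) (Q.c_nonneg k)

theorem h_zero_le_cost (Q : GroupServerQueue K) (d : ℕ → Fin K → ℕ) (n : ℕ) :
    Q.h 0 ≤ Q.cost d n :=
  (Q.h_mono (Nat.zero_le n)).trans (Q.h_le_cost d n)

/-- The uniformized jump chain. -/
noncomputable def walk (hd : Q.IsEfficient d) : BirthDeathWalk where
  p := Q.lam / Q.unifRate
  q n := Q.rate d n / Q.unifRate
  p_pos := div_pos Q.lam_pos Q.unifRate_pos
  q_nonneg n := div_nonneg (Q.rate_nonneg d n) Q.unifRate_pos.le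
  q_zero := by rw [hd.rate_zero, zero_div]
  add_le_one n := by
    rw [← add_div, div_le_one Q.unifRate_pos]
    exact add_le_add_right (hd.rate_le n) Q.lam

theorem walk_p (hd : Q.IsEfficient d) : (walk hd).p = Q.lam / Q.unifRate := rfl

theorem walk_q (hd : Q.IsEfficient d) (n : ℕ) : (walk hd).q n = Q.rate d n / Q.unifRate := rfl

theorem jumpProb_eq (hd : Q.IsEfficient d) (j n m : ℕ) :
    Q.jumpProb d j n m = ((walk hd).trans ^ j) (Pi.single m 1) n := by
  induction j generalizing n with
  | zero =>
    rw [jumpProb, pow_zero, Module.End.one_apply, Pi.single_apply]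
  | succ j ih =>
    rw [jumpProb, BirthDeathWalk.trans_pow_succ]
    have hL := Q.unifRate_pos.ne'
    rcases n with _ | n
    · rw [tsum_eq_sum (s := {0, 1})]
      · rw [Finset.sum_pair (by norm_num), ih, ih]
        simp only [gen, walk_p, walk_q, hd.rate_zero]
        simp
        ring
      · intro i hi
        simp only [Finset.mem_insert, Finset.mem_singleton, not_or] at hi
        have h1 : (0 : ℕ) ≠ i := Ne.symm hi.1
        simp [gen, hi, h1]
    · rw [tsum_eq_sum (s := {n, n + 1, n + 2})]
      · rw [Finset.sum_insert (by simp), Finset.sum_pair (by simp), ih, ih, ih]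
        have h1 : n ≠ n + 1 + 1 := by omega
        simp only [gen, walk_p, walk_q]
        simp [h1]
        ring
      · intro i hi
        simp only [Finset.mem_insert, Finset.mem_singleton, not_or] at hi
        have h1 : n + 1 ≠ i := Ne.symm hi.2.1
        simp [gen, hi, h1]

theorem transProb_eq (hd : Q.IsEfficient d) (t : ℝ) (n m : ℕ) :
    Q.transProb d t n m
      = poissonMix (fun j => ((walk hd).trans ^ j) (Pi.single m 1) n) (Q.unifRate * t) := by
  simp only [transProb, jumpProb_eq hd, poissonMix]

theorem single_one_nonneg (m n : ℕ) : (0 : ℝ) ≤ (Pi.single m 1 : ℕ → ℝ) n := by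
  rw [Pi.single_apply]; split_ifs <;> norm_num

theorem single_one_le (m n : ℕ) : (Pi.single m 1 : ℕ → ℝ) n ≤ 1 := by
  rw [Pi.single_apply]; split_ifs <;> norm_num

theorem poissonSummable_trans_pow (W : BirthDeathWalk) {u : ℕ → ℝ} {C : ℝ} (h0 : ∀ m, 0 ≤ u m)
    (h1 : ∀ m, u m ≤ C) (n : ℕ) : PoissonSummable fun j => (W.trans ^ j) u n := by
  refine poissonSummable_of_bounded (C := C) fun j => ?_
  rw [abs_of_nonneg (W.trans_pow_nonneg j h0 n)]
  have := W.trans_pow_mono j (v := fun _ => C) h1 n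
  rwa [W.trans_pow_const] at this

theorem poissonSummable_trans_single (W : BirthDeathWalk) (n m : ℕ) :
    PoissonSummable fun j => (W.trans ^ j) (Pi.single m 1) n :=
  poissonSummable_trans_pow W (single_one_nonneg m) (single_one_le m) n

theorem transProb_nonneg (hd : Q.IsEfficient d) {t : ℝ} (ht : 0 ≤ t) (n m : ℕ) :
    0 ≤ Q.transProb d t n m := by
  rw [transProb_eq hd]
  exact poissonMix_nonneg (fun j => BirthDeathWalk.trans_pow_nonneg _ j (single_one_nonneg m) n)
    (mul_nonneg Q.unifRate_pos.le ht)

theorem hasSum_trans_pow_single (W : BirthDeathWalk) (a : ℝ) (j n : ℕ) (u : ℕ → ℝ) :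
    HasSum (fun m => a * (W.trans ^ j) (Pi.single m 1) n * u m) (a * (W.trans ^ j) u n) := by
  have h := triStep_pow_eq_sum (a := fun n => 1 - W.p - W.q n) (p := W.p) (q := W.q) j u n
    (n + j + 1) (by omega)
  change (W.trans ^ j) u n = ∑ m ∈ _, (W.trans ^ j) _ n * u m at h
  rw [h, Finset.mul_sum]
  simp only [← mul_assoc]
  refine hasSum_sum_of_ne_finset_zero fun m hm => ?_
  rw [Finset.mem_range] at hm
  have h0 : (W.trans ^ j) (Pi.single m 1) n = 0 := triStep_pow_single_eq_zero j n m (by omega)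
  rw [h0]; ring

/-- Expectations under `transProb` are Poisson mixtures of expectations under the jump chain. -/
theorem transProb_sum_of_nonneg (hd : Q.IsEfficient d) {u : ℕ → ℝ} (hu : ∀ m, 0 ≤ u m)
    {t : ℝ} (ht : 0 ≤ t) (n : ℕ) :
    ((Summable fun m => Q.transProb d t n m * u m) ↔
      Summable fun j : ℕ => Real.exp (-(Q.unifRate * t)) * (Q.unifRate * t) ^ j / (j.factorial : ℝ)
        * ((walk hd).trans ^ j) u n) ∧
    ((Summable fun m => Q.transProb d t n m * u m) → ∑' m, Q.transProb d t n m * u m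
      = poissonMix (fun j => ((walk hd).trans ^ j) u n) (Q.unifRate * t)) := by
  set s := Q.unifRate * t with hs
  have hs0 : 0 ≤ s := mul_nonneg Q.unifRate_pos.le ht
  set W := walk hd
  set F : ℕ → ℕ → ℝ := fun j m => Real.exp (-s) * s ^ j / (j.factorial : ℝ)
    * (W.trans ^ j) (Pi.single m 1) n * u m with hF
  have hF0 : ∀ j m, 0 ≤ F j m := fun j m => mul_nonneg (mul_nonneg (by positivity)
    (W.trans_pow_nonneg j (single_one_nonneg m) n)) (hu m)
  have hrow : ∀ j, HasSum (F j) (Real.exp (-s) * s ^ j / (j.factorial : ℝ) * (W.trans ^ j) u n) :=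
    fun j => hasSum_trans_pow_single W _ j n u
  have hcol : ∀ m, HasSum (fun j => F j m) (Q.transProb d t n m * u m) := by
    intro m
    rw [transProb_eq hd]
    exact ((poissonSummable_trans_single W n m s hs0).hasSum).mul_right (u m)
  have h1 : Summable (fun x : ℕ × ℕ => F x.1 x.2) ↔
      Summable fun j : ℕ => Real.exp (-s) * s ^ j / (j.factorial : ℝ) * (W.trans ^ j) u n := by
    rw [summable_prod_of_nonneg (fun x => hF0 x.1 x.2)]
    simp only [fun j => (hrow j).tsum_eq]
    exact and_iff_right fun j => (hrow j).summable
  have h2 : Summable (fun x : ℕ × ℕ => F x.2 x.1) ↔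
      Summable fun m => Q.transProb d t n m * u m := by
    rw [summable_prod_of_nonneg (fun x => hF0 x.2 x.1)]
    simp only [fun m => (hcol m).tsum_eq]
    exact and_iff_right fun m => (hcol m).summable
  have h3 : Summable (fun x : ℕ × ℕ => F x.2 x.1) ↔ Summable (fun x : ℕ × ℕ => F x.1 x.2) :=
    (Equiv.prodComm ℕ ℕ).summable_iff (f := fun x : ℕ × ℕ => F x.1 x.2)
  refine ⟨h2.symm.trans (h3.trans h1), fun h => ?_⟩
  have hsum := h3.1 (h2.2 h)
  have := hsum.tsum_comm (f := F)
  simp only [fun j => (hrow j).tsum_eq, fun m => (hcol m).tsum_eq] at this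
  exact this

theorem hasSum_transProb (hd : Q.IsEfficient d) {t : ℝ} (ht : 0 ≤ t) (n : ℕ) :
    HasSum (fun m => Q.transProb d t n m) 1 := by
  have h := transProb_sum_of_nonneg hd (u := fun _ => 1) (fun _ => zero_le_one) ht n
  simp only [mul_one, BirthDeathWalk.trans_pow_const] at h
  have hs := h.1.2 (by simpa using PoissonSummable.const 1 _ (mul_nonneg Q.unifRate_pos.le ht))
  have := h.2 hs
  rw [poissonMix_const] at this
  rw [← this]
  exact hs.hasSum

theorem transProb_sum (hd : Q.IsEfficient d) {u : ℕ → ℝ} {b : ℝ} (hu : ∀ m, b ≤ u m)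
    {t : ℝ} (ht : 0 ≤ t) (n : ℕ) :
    ((Summable fun m => Q.transProb d t n m * u m) ↔
      Summable fun j : ℕ => Real.exp (-(Q.unifRate * t)) * (Q.unifRate * t) ^ j / (j.factorial : ℝ)
        * ((walk hd).trans ^ j) u n) ∧
    ((Summable fun m => Q.transProb d t n m * u m) → ∑' m, Q.transProb d t n m * u m
      = poissonMix (fun j => ((walk hd).trans ^ j) u n) (Q.unifRate * t)) := by
  have hs0 : 0 ≤ Q.unifRate * t := mul_nonneg Q.unifRate_pos.le ht
  have h := transProb_sum_of_nonneg hd (u := u - fun _ => b) (fun m => sub_nonneg.2 (hu m)) ht n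
  simp only [map_sub, Pi.sub_apply, BirthDeathWalk.trans_pow_const] at h
  have hb := (hasSum_transProb hd ht n).mul_right b
  have hb2 := PoissonSummable.const b _ hs0
  have e1 : (Summable fun m => Q.transProb d t n m * (u m - b)) ↔
      Summable fun m => Q.transProb d t n m * u m := by
    simp only [mul_sub]
    exact ⟨fun h => by simpa using h.add hb.summable, fun h => h.sub hb.summable⟩
  have e2 : (Summable fun j : ℕ => Real.exp (-(Q.unifRate * t)) * (Q.unifRate * t) ^ j
        / (j.factorial : ℝ) * (((walk hd).trans ^ j) u n - b)) ↔
      Summable fun j : ℕ => Real.exp (-(Q.unifRate * t)) * (Q.unifRate * t) ^ j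
        / (j.factorial : ℝ) * ((walk hd).trans ^ j) u n := by
    simp only [mul_sub]
    exact ⟨fun h => by simpa using h.add hb2, fun h => h.sub hb2⟩
  have hiff := e1.symm.trans (h.1.trans e2)
  refine ⟨hiff, fun hsum => ?_⟩
  have h2 := h.2 (e1.2 hsum)
  have h3 : poissonMix (fun j => ((walk hd).trans ^ j) u n - b) (Q.unifRate * t)
      = poissonMix (fun j => ((walk hd).trans ^ j) u n) (Q.unifRate * t) - b := by
    rw [poissonMix, poissonMix]
    simp only [mul_sub]
    rw [(hiff.1 hsum).tsum_sub hb2]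
    congr 1
    exact poissonMix_const b _
  rw [h3] at h2
  simp only [mul_sub] at h2
  rw [hsum.tsum_sub hb.summable, hb.tsum_eq] at h2
  linarith

theorem poissonSummable_cost (hd : Q.IsEfficient d) {n : ℕ}
    (h : ∀ t, 0 ≤ t → Summable fun m => Q.transProb d t n m * Q.cost d m) :
    PoissonSummable fun j => ((walk hd).trans ^ j) (Q.cost d) n := by
  intro s hs
  have hL := Q.unifRate_pos
  have := (transProb_sum hd (Q.h_zero_le_cost d) (div_nonneg hs hL.le) n).1.1 (h _ (by positivity))
  rwa [mul_div_cancel₀ _ hL.ne'] at this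

theorem expCost_eq (hd : Q.IsEfficient d) {n : ℕ}
    (h : PoissonSummable fun j => ((walk hd).trans ^ j) (Q.cost d) n) {t : ℝ} (ht : 0 ≤ t) :
    (Summable fun m => Q.transProb d t n m * Q.cost d m) ∧ Q.expCost d t n
      = poissonMix (fun j => ((walk hd).trans ^ j) (Q.cost d) n) (Q.unifRate * t) := by
  have h1 := transProb_sum hd (Q.h_zero_le_cost d) ht n
  have h2 := h1.1.2 (h _ (mul_nonneg Q.unifRate_pos.le ht))
  exact ⟨h2, h1.2 h2⟩

theorem intervalIntegrable_expCost (hd : Q.IsEfficient d) {n : ℕ}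
    (h : PoissonSummable fun j => ((walk hd).trans ^ j) (Q.cost d) n) {T : ℝ} (hT : 0 ≤ T) :
    IntervalIntegrable (fun t => Q.expCost d t n) MeasureTheory.volume 0 T := by
  have hc : Continuous fun t => poissonMix (fun j => ((walk hd).trans ^ j) (Q.cost d) n)
    (Q.unifRate * t) := h.continuous.comp (continuous_const.mul continuous_id)
  refine (hc.intervalIntegrable 0 T).congr fun t ht => ?_
  rw [Set.uIoc_of_le hT] at ht
  exact (expCost_eq hd h ht.1.le).2.symm

theorem hasDerivAt_poissonMix_mul {x : ℕ → ℝ} (hx : PoissonSummable x) (L t : ℝ) :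
    HasDerivAt (fun t => poissonMix x (L * t))
      (L * (poissonMix (fun j => x (j + 1)) (L * t) - poissonMix x (L * t))) t := by
  have := (hx.hasDerivAt (L * t)).comp t ((hasDerivAt_id t).const_mul L)
  refine this.congr_deriv ?_
  ring

/-- Dynkin's formula for Poisson mixtures. -/
theorem integral_poissonMix {x y : ℕ → ℝ} (hx : PoissonSummable x) {L : ℝ} (hL : 0 < L)
    (hy : ∀ j, y j = L * (x (j + 1) - x j)) {T : ℝ} (hT : 0 ≤ T) :
    ∫ t in (0 : ℝ)..T, poissonMix y (L * t) = poissonMix x (L * T) - x 0 := by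
  have hy' : PoissonSummable y := by
    rw [funext hy]; exact (hx.succ.sub hx).const_mul L
  have hc : Continuous fun t => poissonMix y (L * t) :=
    hy'.continuous.comp (continuous_const.mul continuous_id)
  rw [intervalIntegral.integral_eq_sub_of_hasDerivAt (f := fun t => poissonMix x (L * t))
    (fun t ht => ?_) (hc.intervalIntegrable _ _), mul_zero, poissonMix_zero]
  rw [Set.uIcc_of_le hT] at ht
  have := hasDerivAt_poissonMix_mul hx L t
  rw [← poissonMix_sub hx.succ hx (mul_nonneg hL.le ht.1), ← poissonMix_const_mul] at this
  rwa [funext hy]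

end GroupServerQueue

namespace GroupServerQueue

variable {K : ℕ} {Q : GroupServerQueue K} {d : ℕ → Fin K → ℕ} {w g : ℕ → ℝ} {η : ℝ}

/-- `w` is a stationary distribution of the number of customers under `d` (in the
detailed balance form available for birth-death processes). -/
structure IsStationary (Q : GroupServerQueue K) (d : ℕ → Fin K → ℕ) (w : ℕ → ℝ) : Prop where
  nonneg : ∀ n, 0 ≤ w n
  hasSum : HasSum w 1
  balance : ∀ n, Q.lam * w n = Q.rate d (n + 1) * w (n + 1)

theorem continuous_transProb (hd : Q.IsEfficient d) (n m : ℕ) :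
    Continuous fun t => Q.transProb d t n m := by
  simp only [transProb_eq hd]
  exact (poissonSummable_trans_single _ n m).continuous.comp (continuous_const.mul continuous_id)

/-- Fraction of the time interval `[0, T]` spent in state `m`, starting from `0`. -/
noncomputable def occupation (Q : GroupServerQueue K) (d : ℕ → Fin K → ℕ) (m : ℕ) (T : ℝ) : ℝ :=
  (1 / T) * ∫ t in (0 : ℝ)..T, Q.transProb d t 0 m

theorem occupation_mem_Icc (hd : Q.IsEfficient d) (m : ℕ) {T : ℝ} (hT : 0 < T) :
    Q.occupation d m T ∈ Set.Icc (0 : ℝ) 1 := by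
  have hi := (continuous_transProb hd 0 m).intervalIntegrable (μ := MeasureTheory.volume) 0 T
  constructor
  · exact mul_nonneg (by positivity)
      (intervalIntegral.integral_nonneg hT.le fun t ht => transProb_nonneg hd ht.1 0 m)
  · have h := intervalIntegral.integral_mono_on hT.le hi
      (intervalIntegrable_const (c := (1 : ℝ)) (μ := MeasureTheory.volume)) fun t ht =>
      le_hasSum (hasSum_transProb hd ht.1 0) m fun i _ => transProb_nonneg hd ht.1 0 i
    rw [intervalIntegral.integral_const, smul_eq_mul, mul_one, sub_zero] at h
    rw [occupation, one_div, inv_mul_le_iff₀ hT]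
    linarith

theorem abs_occupation_flow_le (hd : Q.IsEfficient d) (m : ℕ) {T : ℝ} (hT : 0 < T) :
    |Q.rate d (m + 1) * Q.occupation d (m + 1) T - Q.lam * Q.occupation d m T| ≤ 1 / T := by
  set W := walk hd
  have hL := Q.unifRate_pos
  set u : ℕ → ℝ := fun i => if i ≤ m then 1 else 0 with hu
  have hu0 : ∀ i, 0 ≤ u i := fun i => by simp only [hu]; split_ifs <;> norm_num
  have hu1 : ∀ i, u i ≤ 1 := fun i => by simp only [hu]; split_ifs <;> norm_num
  set x : ℕ → ℝ := fun j => (W.trans ^ j) u 0 with hx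
  have hx0 : ∀ j, 0 ≤ x j := fun j => W.trans_pow_nonneg j hu0 0
  have hx1 : ∀ j, x j ≤ 1 := fun j => by
    have := W.trans_pow_mono j (v := fun _ => 1) hu1 0
    rwa [W.trans_pow_const] at this
  have hxs : PoissonSummable x := poissonSummable_trans_pow W hu0 hu1 0
  have htu : W.trans u = u + (W.q (m + 1) • Pi.single (m + 1) (1 : ℝ)
      - W.p • Pi.single m (1 : ℝ)) := by
    ext i
    rw [W.trans_apply]
    simp only [Pi.add_apply, Pi.sub_apply, Pi.smul_apply, Pi.single_apply, smul_eq_mul, hu]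
    rcases i with _ | i
    · rw [W.q_zero]
      rcases m with _ | m <;> simp
    · rcases lt_trichotomy i m with h | rfl | h
      · by_cases h' : i + 1 = m
        · subst h'; simp
        · have h1 : i + 1 ≤ m := by omega
          have h2 : i + 1 + 1 ≤ m := by omega
          have h3 : i ≤ m := by omega
          have h4 : i ≠ m := by omega
          simp [h1, h2, h3, h4, h']
      · simp
      · have h1 : ¬ i + 1 ≤ m := by omega
        have h2 : ¬ i + 1 + 1 ≤ m := by omega
        have h3 : ¬ i ≤ m := by omega
        have h4 : i ≠ m := by omega
        have h5 : i + 1 ≠ m := by omega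
        simp [h1, h2, h3, h4, h5]
  have hstep : ∀ j, Q.unifRate * (x (j + 1) - x j)
      = Q.rate d (m + 1) * (W.trans ^ j) (Pi.single (m + 1) 1) 0
        - Q.lam * (W.trans ^ j) (Pi.single m 1) 0 := by
    intro j
    simp only [hx]
    rw [pow_succ, Module.End.mul_apply, htu]
    simp only [map_add, map_sub, map_smul, Pi.add_apply, Pi.sub_apply, Pi.smul_apply, smul_eq_mul]
    rw [walk_p, walk_q]
    field_simp
    ring
  have hInt := integral_poissonMix hxs hL (fun j => (hstep j).symm) hT.le
  have hLT : 0 ≤ Q.unifRate * T := by positivity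
  have hm0 := poissonMix_nonneg hx0 hLT
  have hm1 := poissonMix_nonneg (x := fun j => 1 - x j) (fun j => by linarith [hx1 j]) hLT
  rw [poissonMix_sub (.const 1) hxs hLT, poissonMix_const] at hm1
  have hsplit : ∫ t in (0 : ℝ)..T, poissonMix (fun j => Q.rate d (m + 1)
        * (W.trans ^ j) (Pi.single (m + 1) 1) 0 - Q.lam * (W.trans ^ j) (Pi.single m 1) 0)
          (Q.unifRate * t)
      = Q.rate d (m + 1) * (∫ t in (0 : ℝ)..T, Q.transProb d t 0 (m + 1))
        - Q.lam * ∫ t in (0 : ℝ)..T, Q.transProb d t 0 m := by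
    rw [← intervalIntegral.integral_const_mul, ← intervalIntegral.integral_const_mul,
      ← intervalIntegral.integral_sub
        (((continuous_transProb hd 0 (m + 1)).intervalIntegrable 0 T).const_mul _)
        (((continuous_transProb hd 0 m).intervalIntegrable 0 T).const_mul _)]
    refine intervalIntegral.integral_congr fun t ht => ?_
    rw [Set.uIcc_of_le hT.le] at ht
    rw [poissonMix_sub ((poissonSummable_trans_single W 0 (m + 1)).const_mul _)
      ((poissonSummable_trans_single W 0 m).const_mul _) (mul_nonneg hL.le ht.1),
      poissonMix_const_mul, poissonMix_const_mul, transProb_eq hd, transProb_eq hd]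
  have hfin : Q.rate d (m + 1) * Q.occupation d (m + 1) T - Q.lam * Q.occupation d m T
      = (1 / T) * (poissonMix x (Q.unifRate * T) - x 0) := by
    rw [← hInt, hsplit, occupation, occupation]; ring
  rw [hfin, abs_mul, abs_of_pos (by positivity : 0 < 1 / T)]
  refine mul_le_of_le_one_right (by positivity) ?_
  rw [abs_le]
  constructor <;> linarith [hx0 0, hx1 0]

/-- Lower bounds of the cost rate turn into lower bounds of time averages. -/
theorem add_sum_occupation_le (hd : Q.IsEfficient d) (hη : Q.HasAverageCost d η) {a : ℝ}
    {b : ℕ → ℝ} {N : ℕ} (hab : ∀ m, a + (if m < N then b m else 0) ≤ Q.cost d m)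
    {T : ℝ} (hT : 0 < T) :
    a + ∑ m ∈ Finset.range N, b m * Q.occupation d m T
      ≤ (1 / T) * ∫ t in (0 : ℝ)..T, Q.expCost d t 0 := by
  have hc : Continuous fun t => a + ∑ m ∈ Finset.range N, b m * Q.transProb d t 0 m :=
    continuous_const.add (continuous_finsetSum _ fun m _ =>
      continuous_const.mul (continuous_transProb hd 0 m))
  have h := intervalIntegral.integral_mono_on hT.le (hc.intervalIntegrable 0 T)
    ((hη 0).2.1 T hT.le) fun t ht => by
      have hs := hasSum_transProb hd ht.1 0
      have h1 : HasSum (fun m => Q.transProb d t 0 m * (if m < N then b m else 0))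
          (∑ m ∈ Finset.range N, b m * Q.transProb d t 0 m) := by
        have h2 := hasSum_sum_of_ne_finset_zero
          (f := fun m => Q.transProb d t 0 m * (if m < N then b m else 0))
          (s := Finset.range N) (L := .unconditional ℕ) fun m hm => by
            rw [Finset.mem_range] at hm
            simp [hm]
        convert h2 using 1
        refine Finset.sum_congr rfl fun m hm => ?_
        rw [if_pos (Finset.mem_range.1 hm), mul_comm]
      have h3 := (hs.mul_right a).add h1
      rw [one_mul] at h3
      refine hasSum_le (fun m => ?_) h3 ((hη 0).1 t ht.1).hasSum
      rw [← mul_add]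
      exact mul_le_mul_of_nonneg_left (hab m) (transProb_nonneg hd ht.1 0 m)
  have hi : ∀ m, IntervalIntegrable (fun t => b m * Q.transProb d t 0 m)
      MeasureTheory.volume 0 T := fun m =>
    ((continuous_transProb hd 0 m).intervalIntegrable 0 T).const_mul (b m)
  have hc' : Continuous fun t => ∑ m ∈ Finset.range N, b m * Q.transProb d t 0 m :=
    continuous_finsetSum _ fun m _ => continuous_const.mul (continuous_transProb hd 0 m)
  rw [intervalIntegral.integral_add intervalIntegrable_const (hc'.intervalIntegrable 0 T),
    intervalIntegral.integral_finsetSum fun m _ => hi m,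
    intervalIntegral.integral_const, smul_eq_mul, sub_zero] at h
  simp only [intervalIntegral.integral_const_mul] at h
  have h' := mul_le_mul_of_nonneg_left h (by positivity : 0 ≤ 1 / T)
  refine le_trans (le_of_eq ?_) h'
  rw [mul_add, Finset.mul_sum]
  congr 1
  · field_simp
  · exact Finset.sum_congr rfl fun m _ => by rw [occupation]; ring

/-- A policy of finite average cost has a stationary distribution, whose mean cost is at most
the average cost. -/
theorem exists_isStationary (hd : Q.IsEfficient d) (hη : Q.HasAverageCost d η) :
    ∃ w, Q.IsStationary d w ∧ Summable (fun n => w n * Q.cost d n) ∧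
      ∑' n, w n * Q.cost d n ≤ η := by
  set F : Ultrafilter ℝ := Ultrafilter.of atTop
  have hF : (F : Filter ℝ) ≤ atTop := Ultrafilter.of_le atTop
  have hpos : ∀ᶠ T : ℝ in F, 0 < T := hF (eventually_gt_atTop 0)
  have hlim : ∀ m, ∃ x, Tendsto (Q.occupation d m) F (𝓝 x) := by
    intro m
    obtain ⟨x, -, hx⟩ := isCompact_Icc.ultrafilter_le_nhds (F.map (Q.occupation d m))
      (by
        rw [Filter.le_principal_iff]
        exact hpos.mono fun T hT => occupation_mem_Icc hd m hT)
    exact ⟨x, hx⟩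
  choose w hw using hlim
  have hcost := (hη 0).2.2.mono_left hF
  have hinv : Tendsto (fun T : ℝ => 1 / T) F (𝓝 0) := by
    simpa using tendsto_inv_atTop_zero.mono_left hF
  have hw0 : ∀ m, 0 ≤ w m := fun m => ge_of_tendsto (hw m) <|
    hpos.mono fun T hT => (occupation_mem_Icc hd m hT).1
  have hlow : ∀ {a : ℝ} {b : ℕ → ℝ} {N : ℕ},
      (∀ m, a + (if m < N then b m else 0) ≤ Q.cost d m) →
      a + ∑ m ∈ Finset.range N, b m * w m ≤ η := by
    intro a b N hab
    refine le_of_tendsto_of_tendsto (tendsto_const_nhds.add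
      (tendsto_finsetSum (Finset.range N) fun m _ => (hw m).const_mul (b m))) hcost ?_
    exact hpos.mono fun T hT => add_sum_occupation_le hd hη hab hT
  have hsum_le : ∀ N, ∑ m ∈ Finset.range N, w m ≤ 1 := by
    intro N
    refine le_of_tendsto (tendsto_finsetSum (Finset.range N) fun m _ => hw m) ?_
    filter_upwards [hpos] with T hT
    have hi : ∀ m, IntervalIntegrable (fun t => Q.transProb d t 0 m) MeasureTheory.volume 0 T :=
      fun m => (continuous_transProb hd 0 m).intervalIntegrable 0 T
    simp only [occupation]
    rw [← Finset.mul_sum, ← intervalIntegral.integral_finsetSum fun m _ => hi m, one_div,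
      inv_mul_le_iff₀ hT]
    have h := intervalIntegral.integral_mono_on hT.le
      ((continuous_finsetSum (Finset.range N) fun m _ =>
        continuous_transProb hd 0 m).intervalIntegrable (μ := MeasureTheory.volume) 0 T)
      (intervalIntegrable_const (c := (1 : ℝ)) (μ := MeasureTheory.volume)) fun t ht =>
      sum_le_hasSum _ (fun i _ => transProb_nonneg hd ht.1 0 i) (hasSum_transProb hd ht.1 0)
    rw [intervalIntegral.integral_const, smul_eq_mul, sub_zero] at h
    exact h
  have htight : ∀ N, (Q.h N - Q.h 0) * (1 - ∑ m ∈ Finset.range N, w m) ≤ η - Q.h 0 := by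
    intro N
    have h := hlow (a := Q.h N) (b := fun _ => Q.h 0 - Q.h N) (N := N) (fun m => by
      split_ifs with hm
      · linarith [Q.h_zero_le_cost d m]
      · linarith [Q.h_mono (not_lt.1 hm), Q.h_le_cost d m])
    rw [← Finset.mul_sum] at h
    linarith
  have hone : HasSum w 1 := by
    rw [hasSum_iff_tendsto_nat_of_nonneg hw0]
    have h1 : Tendsto (fun N => Q.h N - Q.h 0) atTop atTop :=
      tendsto_atTop_add_const_right _ _ Q.h_tendsto
    have h2 : Tendsto (fun N => 1 - (η - Q.h 0) / (Q.h N - Q.h 0)) atTop (𝓝 1) := by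
      simpa using tendsto_const_nhds.sub (h1.const_div_atTop (η - Q.h 0))
    refine tendsto_of_tendsto_of_tendsto_of_le_of_le' h2 tendsto_const_nhds ?_
      (Eventually.of_forall hsum_le)
    filter_upwards [h1.eventually_gt_atTop 0] with N hN
    have := htight N
    rw [mul_comm, ← le_div_iff₀ hN] at this
    linarith
  have hdiff : ∀ N, ∑ m ∈ Finset.range N, w m * (Q.cost d m - Q.h 0) ≤ η - Q.h 0 := by
    intro N
    have h := hlow (a := Q.h 0) (b := fun m => Q.cost d m - Q.h 0) (N := N) (fun m => by
      split_ifs with hm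
      · linarith
      · linarith [Q.h_zero_le_cost d m])
    simp only [mul_comm (w _)]
    linarith
  have hnn : ∀ m, 0 ≤ w m * (Q.cost d m - Q.h 0) := fun m =>
    mul_nonneg (hw0 m) (by linarith [Q.h_zero_le_cost d m])
  have hs := summable_of_sum_range_le hnn hdiff
  have hle := Real.tsum_le_of_sum_range_le hnn hdiff
  have hs' : Summable fun n => w n * Q.cost d n := by
    have := hs.add (hone.mul_right (Q.h 0)).summable
    refine this.congr fun n => ?_
    ring
  refine ⟨w, ⟨hw0, hone, fun n => ?_⟩, hs', ?_⟩
  · have h1 : Tendsto (fun T => Q.rate d (n + 1) * Q.occupation d (n + 1) T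
        - Q.lam * Q.occupation d n T) F (𝓝 0) :=
      squeeze_zero_norm' (hpos.mono fun T hT => abs_occupation_flow_le hd n hT) hinv
    have h2 := ((hw (n + 1)).const_mul (Q.rate d (n + 1))).sub ((hw n).const_mul Q.lam)
    linarith [tendsto_nhds_unique h1 h2]
  · simp only [mul_sub] at hle
    rw [hs'.tsum_sub (hone.mul_right _).summable, (hone.mul_right _).tsum_eq] at hle
    linarith

theorem HasAverageCost.unique {η' : ℝ} (h : Q.HasAverageCost d η) (h' : Q.HasAverageCost d η') :
    η = η' :=
  tendsto_nhds_unique (h 0).2.2 (h' 0).2.2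

theorem IsStationary.eq_zero_of_succ (hw : Q.IsStationary d w) {n : ℕ}
    (h : Q.rate d (n + 1) * w (n + 1) = 0) {m : ℕ} (hm : m ≤ n) : w m = 0 := by
  induction hm using Nat.decreasingInduction with
  | self =>
    rw [← hw.balance n] at h
    exact (mul_eq_zero.1 h).resolve_left Q.lam_pos.ne'
  | of_succ m _ ih =>
    have := hw.balance m
    rw [ih, mul_zero] at this
    exact (mul_eq_zero.1 this).resolve_left Q.lam_pos.ne'

theorem IsStationary.exists_ne_zero (hw : Q.IsStationary d w) : ∃ n, w n ≠ 0 := by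
  by_contra! h
  have := hw.hasSum
  rw [funext h] at this
  exact zero_ne_one (hasSum_zero.unique this)

theorem IsStationary.pos_of_le (hw : Q.IsStationary d w) {N : ℕ}
    (hr : ∀ n, N ≤ n → 0 < Q.rate d (n + 1)) {n : ℕ} (hn : N ≤ n) : 0 < w n := by
  have hN : 0 < w N := by
    refine (hw.nonneg N).lt_of_ne' fun h0 => ?_
    have hz : ∀ n, N ≤ n → w n = 0 := by
      intro n hn
      induction hn with
      | refl => exact h0
      | @step m hn ih =>
        have := hw.balance m
        rw [ih, mul_zero] at this
        exact (mul_eq_zero.1 this.symm).resolve_left (hr _ hn).ne'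
    obtain ⟨m, hm⟩ := hw.exists_ne_zero
    rcases le_total N m with h | h
    · exact hm (hz m h)
    · exact hm (hw.eq_zero_of_succ (n := N) (by rw [hz (N + 1) (by omega), mul_zero]) h)
  induction hn with
  | refl => exact hN
  | @step m hn ih =>
    have := mul_pos Q.lam_pos ih
    rw [hw.balance m] at this
    exact (mul_pos_iff_of_pos_left (hr _ hn)).1 this

theorem IsStationary.pos (hw : Q.IsStationary d w) (hr : ∀ n, 0 < Q.rate d (n + 1)) (n : ℕ) :
    0 < w n :=
  hw.pos_of_le (fun n _ => hr n) (Nat.zero_le n)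

theorem IsStationary.isReversible (hd : Q.IsEfficient d) (hw : Q.IsStationary d w)
    (hr : ∀ n, 0 < Q.rate d (n + 1)) : (walk hd).IsReversible w where
  pos := hw.pos hr
  hasSum := hw.hasSum
  balance n := by
    rw [walk_p, walk_q, div_mul_eq_mul_div, div_mul_eq_mul_div, hw.balance n]

theorem tendsto_unifRate_mul (Q : GroupServerQueue K) :
    Tendsto (fun T => Q.unifRate * T) atTop atTop :=
  tendsto_id.const_mul_atTop Q.unifRate_pos

/-- The average cost of an irreducible policy is the mean cost in stationarity. -/
theorem IsStationary.hasAverageCost (hd : Q.IsEfficient d) (hw : Q.IsStationary d w)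
    (hr : ∀ n, 0 < Q.rate d (n + 1)) (hη : HasSum (fun n => w n * Q.cost d n) η) :
    Q.HasAverageCost d η := by
  intro n
  obtain ⟨hs, hl⟩ := tendsto_poissonMix ((hw.isReversible hd hr).tendsto_trans_pow hη n)
  refine ⟨fun t ht => (expCost_eq hd hs ht).1,
    fun T hT => intervalIntegrable_expCost hd hs hT,
    tendsto_average_of_tendsto (fun T hT => intervalIntegrable_expCost hd hs hT) ?_⟩
  refine (hl.comp Q.tendsto_unifRate_mul).congr' ?_
  filter_upwards [eventually_ge_atTop 0] with t ht
  exact (expCost_eq hd hs ht).2.symm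

theorem IsStationary.isPotential (hd : Q.IsEfficient d) (hw : Q.IsStationary d w)
    (hr : ∀ n, 0 < Q.rate d (n + 1)) (hη : HasSum (fun n => w n * Q.cost d n) η) :
    Q.IsPotential d fun n => (walk hd).poissonSol w (Q.cost d) η n / Q.unifRate := by
  refine ⟨η, hw.hasAverageCost hd hr hη, fun n => ?_⟩
  have hrev := hw.isReversible hd hr
  have hL := Q.unifRate_pos
  set W := walk hd
  set g := W.poissonSol w (Q.cost d) η with hg
  have hs : ∀ n, PoissonSummable fun j => (W.trans ^ j) (Q.cost d) n := fun n =>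
    (tendsto_poissonMix (hrev.tendsto_trans_pow hη n)).1
  set x : ℕ → ℝ := fun j => -((W.trans ^ j) g n - (W.trans ^ j) g 0) / Q.unifRate with hx
  have hxl : Tendsto x atTop (𝓝 0) := by
    have := ((hrev.tendsto_trans_pow_poissonSol hη n).neg).div_const Q.unifRate
    rwa [neg_zero, zero_div] at this
  obtain ⟨hxs, hxm⟩ := tendsto_poissonMix hxl
  have hstep : ∀ j, (W.trans ^ j) (Q.cost d) n - (W.trans ^ j) (Q.cost d) 0
      = Q.unifRate * (x (j + 1) - x j) := by
    intro j
    simp only [hx]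
    rw [hg, hrev.trans_pow_succ_poissonSol, hrev.trans_pow_succ_poissonSol]
    field_simp
    ring
  have hval : ∀ T, 0 ≤ T → (∫ t in (0 : ℝ)..T, (Q.expCost d t n - η))
      - ∫ t in (0 : ℝ)..T, (Q.expCost d t 0 - η) = poissonMix x (Q.unifRate * T) - x 0 := by
    intro T hT
    rw [← integral_poissonMix hxs hL hstep hT, ← intervalIntegral.integral_sub
      ((intervalIntegrable_expCost hd (hs n) hT).sub intervalIntegrable_const)
      ((intervalIntegrable_expCost hd (hs 0) hT).sub intervalIntegrable_const)]
    refine intervalIntegral.integral_congr fun t ht => ?_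
    rw [Set.uIcc_of_le hT] at ht
    rw [poissonMix_sub (hs n) (hs 0) (mul_nonneg hL.le ht.1), (expCost_eq hd (hs n) ht.1).2,
      (expCost_eq hd (hs 0) ht.1).2]
    ring
  have hlim := (hxm.comp Q.tendsto_unifRate_mul).sub_const (x 0)
  have hend : (0 : ℝ) - x 0 = g n / Q.unifRate - g 0 / Q.unifRate := by
    simp only [hx, pow_zero, Module.End.one_apply]; ring
  rw [hend] at hlim
  refine hlim.congr' ?_
  filter_upwards [eventually_ge_atTop 0] with T hT
  exact (hval T hT).symm

/-- Potentials solve the Poisson equation. -/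
theorem IsPotential.poisson_eq (hd : Q.IsEfficient d) (hg : Q.IsPotential d g)
    (hη : Q.HasAverageCost d η) (n : ℕ) :
    Q.lam * (g (n + 1) - g n) - Q.rate d n * (g n - g (n - 1)) = η - Q.cost d n := by
  obtain ⟨η', hη', hlim⟩ := hg
  obtain rfl := hη.unique hη'
  have hL := Q.unifRate_pos
  set W := walk hd
  have hs : ∀ n, PoissonSummable fun j => (W.trans ^ j) (Q.cost d) n := fun n =>
    poissonSummable_cost hd (hη n).1
  set D : ℕ → ℝ → ℝ := fun n T => (∫ t in (0 : ℝ)..T, (Q.expCost d t n - η))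
        - ∫ t in (0 : ℝ)..T, (Q.expCost d t 0 - η) with hD
  have hstep : ∀ j, (Q.lam * ((W.trans ^ j) (Q.cost d) (n + 1) - (W.trans ^ j) (Q.cost d) n)
      - Q.rate d n * ((W.trans ^ j) (Q.cost d) n - (W.trans ^ j) (Q.cost d) (n - 1)))
      = Q.unifRate * ((W.trans ^ (j + 1)) (Q.cost d) n - (W.trans ^ j) (Q.cost d) n) := by
    intro j
    rw [W.trans_pow_succ, walk_p, walk_q]
    field_simp
    ring
  have hval : ∀ T, 0 ≤ T → Q.lam * (D (n + 1) T - D n T) - Q.rate d n * (D n T - D (n - 1) T)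
      = Q.expCost d T n - Q.cost d n := by
    intro T hT
    have hi : ∀ m, IntervalIntegrable (fun t => Q.expCost d t m - η) MeasureTheory.volume 0 T :=
      fun m => (intervalIntegrable_expCost hd (hs m) hT).sub intervalIntegrable_const
    rw [(expCost_eq hd (hs n) hT).2]
    have h := integral_poissonMix (hs n) hL hstep hT
    simp only [pow_zero, Module.End.one_apply] at h
    rw [← h]
    simp only [hD]
    rw [sub_sub_sub_cancel_right, sub_sub_sub_cancel_right,
      ← intervalIntegral.integral_sub (hi _) (hi _), ← intervalIntegral.integral_sub (hi _) (hi _),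
      ← intervalIntegral.integral_const_mul, ← intervalIntegral.integral_const_mul,
      ← intervalIntegral.integral_sub (((hi _).sub (hi _)).const_mul _)
        (((hi _).sub (hi _)).const_mul _)]
    refine intervalIntegral.integral_congr fun t ht => ?_
    rw [Set.uIcc_of_le hT] at ht
    have ht' := mul_nonneg hL.le ht.1
    rw [poissonMix_sub (((hs _).sub (hs _)).const_mul _) (((hs _).sub (hs _)).const_mul _) ht',
      poissonMix_const_mul, poissonMix_const_mul, poissonMix_sub (hs _) (hs _) ht',
      poissonMix_sub (hs _) (hs _) ht', (expCost_eq hd (hs _) ht.1).2,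
      (expCost_eq hd (hs _) ht.1).2, (expCost_eq hd (hs _) ht.1).2]
    ring
  have h1 := (((hlim (n + 1)).sub (hlim n)).const_mul Q.lam).sub
    (((hlim n).sub (hlim (n - 1))).const_mul (Q.rate d n))
  have h2 : Tendsto (fun T => Q.expCost d T n) atTop (𝓝 (Q.lam * (g (n + 1) - g n)
      - Q.rate d n * (g n - g (n - 1)) + Q.cost d n)) := by
    rw [sub_sub_sub_cancel_right, sub_sub_sub_cancel_right] at h1
    refine (h1.add_const (Q.cost d n)).congr' ?_
    filter_upwards [eventually_ge_atTop 0] with T hT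
    linarith [hval T hT]
  have h3 := tendsto_nhds_unique (hη n).2.2
    (tendsto_average_of_tendsto (hη n).2.1 h2)
  linarith

end GroupServerQueue

namespace GroupServerQueue

variable {K : ℕ} {Q : GroupServerQueue K} {d : ℕ → Fin K → ℕ} {w g G : ℕ → ℝ} {η : ℝ}

/-- Net benefit rate of the action `a` if serving a customer is worth `x`. -/
noncomputable def net (Q : GroupServerQueue K) (a : Fin K → ℕ) (x : ℝ) : ℝ :=
  ∑ k, (a k : ℝ) * (Q.mu k * x - Q.c k)

/-- The action `b` obeys the `c/μ`-rule in state `n` if serving a customer is worth `x`. -/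
def ObeysRule (Q : GroupServerQueue K) (n : ℕ) (x : ℝ) (b : Fin K → ℕ) : Prop :=
  ∀ k, (Q.c k / Q.mu k < x → b k = min (Q.M k) (n - ∑ l ∈ Finset.Iio k, b l)) ∧
    (x < Q.c k / Q.mu k → b k = 0)

theorem cost_eq (Q : GroupServerQueue K) (d : ℕ → Fin K → ℕ) (n : ℕ) (x : ℝ) :
    Q.cost d n = Q.h n + Q.rate d n * x - Q.net (d n) x := by
  simp only [cost, rate, net, mul_sub, Finset.sum_sub_distrib, Finset.sum_mul]
  simp only [← mul_assoc]
  ring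

theorem reward_eq (Q : GroupServerQueue K) (k : Fin K) (x : ℝ) :
    Q.mu k * x - Q.c k = Q.mu k * (x - Q.c k / Q.mu k) := by
  have := (Q.mu_pos k).ne'
  field_simp

theorem reward_pos_iff (Q : GroupServerQueue K) (k : Fin K) (x : ℝ) :
    0 < Q.mu k * x - Q.c k ↔ Q.c k / Q.mu k < x := by
  rw [reward_eq, mul_pos_iff_of_pos_left (Q.mu_pos k), sub_pos]

theorem reward_neg_iff (Q : GroupServerQueue K) (k : Fin K) (x : ℝ) :
    Q.mu k * x - Q.c k < 0 ↔ x < Q.c k / Q.mu k := by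
  rw [reward_eq, mul_neg_iff, sub_neg]
  have := Q.mu_pos k
  constructor
  · rintro (h | h)
    · exact h.2
    · exact absurd this (not_lt.2 h.1.le)
  · exact fun h => Or.inl ⟨this, h⟩

/-- Under scale economies, a group that comes later in the order is strictly less rewarding. -/
theorem ScaleEconomies.reward_lt (hQ : Q.ScaleEconomies) {k l : Fin K} (hkl : k < l) {x : ℝ}
    (hk : 0 < Q.mu k * x - Q.c k) : Q.mu l * x - Q.c l < Q.mu k * x - Q.c k := by
  rcases le_or_gt (Q.mu l * x - Q.c l) 0 with hl | hl
  · exact hl.trans_lt hk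
  have h1 : Q.c k / Q.mu k ≤ Q.c l / Q.mu l := hQ.1 hkl.le
  have h2 : Q.mu l ≤ Q.mu k := hQ.2 hkl.le
  have hx := (Q.reward_pos_iff l x).1 hl
  rw [reward_eq, reward_eq]
  rcases h2.lt_or_eq with h2 | h2
  · calc Q.mu l * (x - Q.c l / Q.mu l) < Q.mu k * (x - Q.c l / Q.mu l) :=
          mul_lt_mul_of_pos_right h2 (sub_pos.2 hx)
      _ ≤ _ := mul_le_mul_of_nonneg_left (by linarith) (Q.mu_pos k).le
  · rw [h2]
    rw [h2] at h1
    refine mul_lt_mul_of_pos_left ?_ (Q.mu_pos k)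
    have hc : Q.c k ≠ Q.c l := (Q.heterogeneous k l hkl.ne).resolve_left (not_not.2 h2.symm)
    have h3 : Q.c k / Q.mu k ≠ Q.c l / Q.mu k := fun h =>
      hc ((div_left_inj' (Q.mu_pos k).ne').1 h)
    have := lt_of_le_of_ne h1 h3
    linarith

/-- The `c/μ`-rule picks a best action. -/
theorem ObeysRule.net_le (hQ : Q.ScaleEconomies) {n : ℕ} {x : ℝ} {a b : Fin K → ℕ}
    (hb : Q.ObeysRule n x b) (hbn : ∑ k, b k ≤ n) (ha : ∀ k, a k ≤ Q.M k)
    (han : ∑ k, a k ≤ n) : Q.net a x ≤ Q.net b x := by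
  have hzero : ∀ k, Q.mu k * x - Q.c k < 0 → b k = 0 := fun k hk =>
    (hb k).2 ((Q.reward_neg_iff k x).1 hk)
  by_cases hex : ∃ k, 0 < Q.mu k * x - Q.c k ∧ b k ≠ Q.M k
  · obtain ⟨k, hk, hmin⟩ := Finset.exists_min_image
      (Finset.univ.filter fun k => 0 < Q.mu k * x - Q.c k ∧ b k ≠ Q.M k) id
      (by obtain ⟨k, hk⟩ := hex; exact ⟨k, by simpa using hk⟩)
    simp only [Finset.mem_filter, Finset.mem_univ, true_and, id] at hk hmin
    have hbk := (hb k).1 ((Q.reward_pos_iff k x).1 hk.1)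
    have hIio : ∑ l ∈ Finset.Iio k, b l ≤ ∑ l, b l :=
      Finset.sum_le_sum_of_subset (Finset.subset_univ _)
    have hbk' : b k = n - ∑ l ∈ Finset.Iio k, b l := by
      have := hk.2
      omega
    have hlate : ∀ l, k < l → b l = 0 := by
      intro l hl
      have h1 : ∑ i ∈ insert l (insert k (Finset.Iio k)), b i ≤ ∑ i, b i :=
        Finset.sum_le_sum_of_subset (Finset.subset_univ _)
      rw [Finset.sum_insert (by simp [hl]), Finset.sum_insert (by simp)] at h1
      omega
    have hbn' : ∑ l, b l = n := by
      have h1 : ∑ i ∈ insert k (Finset.Iio k), b i ≤ ∑ i, b i :=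
        Finset.sum_le_sum_of_subset (Finset.subset_univ _)
      rw [Finset.sum_insert (by simp)] at h1
      omega
    set θ := Q.mu k * x - Q.c k with hθ
    have hterm : ∀ l, 0 ≤ ((b l : ℝ) - a l) * ((Q.mu l * x - Q.c l) - θ) := by
      intro l
      rcases lt_trichotomy l k with hl | rfl | hl
      · have hpos : 0 < Q.mu l * x - Q.c l := by
          rw [reward_pos_iff] at hk ⊢
          exact lt_of_le_of_lt (hQ.1 hl.le) hk.1
        have hM : b l = Q.M l := by
          by_contra hne
          exact absurd (hmin l ⟨hpos, hne⟩) (not_le.2 hl)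
        refine mul_nonneg ?_ ?_
        · rw [hM, sub_nonneg]; exact_mod_cast ha l
        · exact sub_nonneg.2 (hQ.reward_lt hl hpos).le
      · simp [hθ]
      · rw [hlate l hl]
        have := hQ.reward_lt hl hk.1
        have ha0 : (0 : ℝ) ≤ a l := Nat.cast_nonneg _
        push_cast
        nlinarith
    have hsum := Finset.sum_nonneg fun l (_ : l ∈ Finset.univ) => hterm l
    have han' : (∑ k, (a k : ℝ)) ≤ n := by exact_mod_cast han
    have hbn'' : (∑ k, (b k : ℝ)) = n := by exact_mod_cast hbn'
    have hexp : ∑ l, ((b l : ℝ) - a l) * ((Q.mu l * x - Q.c l) - θ)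
        = Q.net b x - Q.net a x - θ * ((∑ l, (b l : ℝ)) - ∑ l, (a l : ℝ)) := by
      simp only [net]
      rw [← Finset.sum_sub_distrib, ← Finset.sum_sub_distrib, Finset.mul_sum,
        ← Finset.sum_sub_distrib]
      exact Finset.sum_congr rfl fun l _ => by ring
    rw [hexp, hbn''] at hsum
    have := mul_nonneg hk.1.le (sub_nonneg.2 han')
    linarith
  · push Not at hex
    refine Finset.sum_le_sum fun k _ => ?_
    rcases lt_trichotomy (Q.mu k * x - Q.c k) 0 with h | h | h
    · rw [hzero k h]
      have ha0 : (0 : ℝ) ≤ a k := Nat.cast_nonneg _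
      push_cast
      nlinarith
    · rw [h]; simp
    · rw [hex k h]
      exact mul_le_mul_of_nonneg_right (Nat.cast_le.2 (ha k)) h.le

theorem ObeysRule.net_nonneg {n : ℕ} {x : ℝ} {b : Fin K → ℕ} (hb : Q.ObeysRule n x b) :
    0 ≤ Q.net b x := by
  refine Finset.sum_nonneg fun k _ => ?_
  rcases lt_or_ge (Q.mu k * x - Q.c k) 0 with h | h
  · rw [(hb k).2 ((Q.reward_neg_iff k x).1 h)]; simp
  · exact mul_nonneg (Nat.cast_nonneg _) h

/-- `G` satisfies the Poisson equation of the policy `d` with average cost `η`. -/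
def SolvesPoisson (Q : GroupServerQueue K) (d : ℕ → Fin K → ℕ) (η : ℝ) (G : ℕ → ℝ) : Prop :=
  ∀ n, Q.lam * G (n + 1) = η - Q.h n + Q.net (d n) (G n)

theorem IsPotential.solvesPoisson (hd : Q.IsEfficient d) (hg : Q.IsPotential d g)
    (hη : Q.HasAverageCost d η) : Q.SolvesPoisson d η (prf g) := by
  intro n
  have h := hg.poisson_eq hd hη n
  rw [Q.cost_eq d n (prf g n)] at h
  simp only [prf, Nat.add_sub_cancel] at h ⊢
  linarith

/-- Performance difference formula, truncated at `N`. -/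
theorem SolvesPoisson.sum_eq {d' : ℕ → Fin K → ℕ} (hG : Q.SolvesPoisson d η G)
    (hd' : Q.IsEfficient d') (hw : Q.IsStationary d' w) (N : ℕ) :
    ∑ i ∈ Finset.range (N + 1), w i * (Q.cost d' i - η) + Q.lam * w N * G (N + 1)
      = ∑ i ∈ Finset.range (N + 1), w i * (Q.net (d i) (G i) - Q.net (d' i) (G i)) := by
  induction N with
  | zero =>
    simp only [zero_add, Finset.range_one, Finset.sum_singleton]
    have h1 := hG 0
    have h2 := Q.cost_eq d' 0 (G 0)
    rw [hd'.rate_zero] at h2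
    rw [zero_add] at h1
    linear_combination w 0 * h1 + w 0 * h2
  | succ N ih =>
    rw [Finset.sum_range_succ, Finset.sum_range_succ _ (N + 1), ← ih]
    have h1 := hG (N + 1)
    have h2 := Q.cost_eq d' (N + 1) (G (N + 1))
    have h3 := hw.balance N
    linear_combination w (N + 1) * h1 + w (N + 1) * h2 - G (N + 1) * h3

theorem SolvesPoisson.lam_mul_eq (hG : Q.SolvesPoisson d η G) (hd : Q.IsEfficient d)
    (hw : Q.IsStationary d w) (N : ℕ) :
    Q.lam * w N * G (N + 1) = -∑ i ∈ Finset.range (N + 1), w i * (Q.cost d i - η) := by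
  have := hG.sum_eq hd hw N
  simp only [sub_self, mul_zero, Finset.sum_const_zero] at this
  linarith

/-- Some group has a server, and the first such group has the smallest ratio `c/μ`. -/
theorem ScaleEconomies.exists_first (hQ : Q.ScaleEconomies) (hd : Q.IsEfficient d)
    (hw : Q.IsStationary d w) :
    ∃ k, 0 < Q.M k ∧ (∀ l < k, Q.M l = 0) ∧
      ∀ l, 0 < Q.M l → Q.c k / Q.mu k ≤ Q.c l / Q.mu l := by
  have hex : ∃ k, 0 < Q.M k := by
    by_contra! h
    have hr : ∀ n, Q.rate d n = 0 := fun n => Finset.sum_eq_zero fun k _ => by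
      have := (hd n).1 k
      rw [Nat.le_zero.1 (this.trans (h k))]; simp
    obtain ⟨n, hn⟩ := hw.exists_ne_zero
    exact hn (hw.eq_zero_of_succ (by rw [hr, zero_mul]) le_rfl)
  obtain ⟨k, hk, hmin⟩ := Finset.exists_min_image
    (Finset.univ.filter fun k => 0 < Q.M k) id (by obtain ⟨k, hk⟩ := hex; exact ⟨k, by simpa⟩)
  simp only [Finset.mem_filter, Finset.mem_univ, true_and, id] at hk hmin
  refine ⟨k, hk, fun l hl => ?_, fun l hl => hQ.1 (hmin l hl)⟩
  by_contra hne
  exact absurd (hmin l (Nat.pos_of_ne_zero hne)) (not_le.2 hl)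

theorem IsStationary.exists_rate_pos (hw : Q.IsStationary d w) (N : ℕ) :
    ∃ n, N ≤ n ∧ Q.rate d (n + 1) ≠ 0 := by
  by_contra! h
  obtain ⟨m, hm⟩ := hw.exists_ne_zero
  exact hm (hw.eq_zero_of_succ (n := max N m) (by rw [h _ (le_max_left _ _), zero_mul])
    (le_max_right _ _))

theorem rate_pos_of_pos {n : ℕ} {k : Fin K} (hk : 0 < d n k) : 0 < Q.rate d n :=
  Finset.sum_pos' (fun k _ => mul_nonneg (Nat.cast_nonneg _) (Q.mu_pos k).le)
    ⟨k, Finset.mem_univ k, mul_pos (Nat.cast_pos.2 hk) (Q.mu_pos k)⟩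

/-- Under the `c/μ`-rule, serving a customer is always worth more than the smallest `c/μ`. -/
theorem SolvesPoisson.lt_of_obeysRule (hG : Q.SolvesPoisson d η G)
    (hd : Q.IsEfficient d) (hw : Q.IsStationary d w) (hrule : ∀ n, Q.ObeysRule n (G n) (d n))
    {κ : ℝ} (hκ : ∀ l, 0 < Q.M l → κ ≤ Q.c l / Q.mu l) (n : ℕ) : κ < G (n + 1) := by
  by_contra! hn
  have hlam := Q.lam_pos
  have hnet : ∀ m, G m ≤ κ → Q.net (d m) (G m) = 0 := by
    intro m hm
    refine Finset.sum_eq_zero fun k _ => ?_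
    rcases Nat.eq_zero_or_pos (d m k) with h | h
    · rw [h]; simp
    · have h1 : Q.c k / Q.mu k ≤ G m := by
        by_contra! h'
        exact h.ne' ((hrule m k).2 h')
      have h2 := hκ k (h.trans_le ((hd m).1 k))
      have h3 : G m = Q.c k / Q.mu k := le_antisymm (hm.trans h2) h1
      rw [reward_eq, h3, sub_self, mul_zero, mul_zero]
  have hh : η - Q.h n ≤ Q.lam * κ := by
    have := hG n
    have := (hrule n).net_nonneg
    have := mul_le_mul_of_nonneg_left hn hlam.le
    linarith
  have hle : ∀ m, n ≤ m → G (m + 1) ≤ κ := by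
    intro m hm
    induction hm with
    | refl => exact hn
    | @step m hm ih =>
      have h1 := hG (m + 1)
      rw [hnet _ ih] at h1
      have h2 := Q.h_mono (Nat.le_succ_of_le hm)
      have h3 : Q.lam * G (m + 1 + 1) ≤ Q.lam * κ := by linarith
      exact le_of_mul_le_mul_left h3 hlam
  obtain ⟨N, hN⟩ := (Q.h_tendsto.eventually_gt_atTop (Q.h n)).exists_forall_of_atTop
  obtain ⟨m, hm, hrm⟩ := hw.exists_rate_pos (max N n + 1)
  refine hrm (Finset.sum_eq_zero fun k _ => ?_)
  rcases Nat.eq_zero_or_pos (d (m + 1) k) with h | h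
  · rw [h]; simp
  exfalso
  have h2 := hκ k (h.trans_le ((hd (m + 1)).1 k))
  have h1 : Q.c k / Q.mu k ≤ G (m + 1) := by
    by_contra! h'
    exact h.ne' ((hrule (m + 1) k).2 h')
  obtain ⟨m, rfl⟩ : ∃ m', m = m' + 1 := ⟨m - 1, by omega⟩
  have h3 := hG (m + 1)
  rw [hnet _ (hle m (by have := le_max_right N n; omega))] at h3
  have h4 := hN (m + 1) (by have := le_max_left N n; omega)
  have h5 : Q.lam * G (m + 1 + 1) < Q.lam * κ := by linarith
  have := lt_of_mul_lt_mul_left h5 hlam.le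
  linarith

theorem ObeysRule.pos {n : ℕ} {x : ℝ} {b : Fin K → ℕ} (hb : Q.ObeysRule (n + 1) x b)
    (hbM : ∀ k, b k ≤ Q.M k) {k : Fin K} (hk : 0 < Q.M k) (hfirst : ∀ l < k, Q.M l = 0)
    (hx : Q.c k / Q.mu k < x) : 0 < b k := by
  rw [(hb k).1 hx, Finset.sum_eq_zero fun l hl =>
    Nat.le_zero.1 ((hbM l).trans_eq (hfirst l (Finset.mem_Iio.1 hl)))]
  omega

theorem ObeysRule.eq_of_le {n : ℕ} {x : ℝ} {b : Fin K → ℕ} (hb : Q.ObeysRule n x b)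
    (hbM : ∀ k, b k ≤ Q.M k) (hn : ∑ k, Q.M k ≤ n) (hx : ∀ k, Q.c k / Q.mu k < x) (k : Fin K) :
    b k = Q.M k := by
  rw [(hb k).1 (hx k)]
  have h1 : ∑ l ∈ Finset.Iio k, b l ≤ ∑ l ∈ Finset.Iio k, Q.M l :=
    Finset.sum_le_sum fun l _ => hbM l
  have h2 : ∑ i ∈ insert k (Finset.Iio k), Q.M i ≤ ∑ i, Q.M i :=
    Finset.sum_le_sum_of_subset (Finset.subset_univ _)
  rw [Finset.sum_insert (by simp)] at h2
  omega

theorem hasSum_cost_sub (hw : Q.IsStationary d w) (hη : HasSum (fun n => w n * Q.cost d n) η)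
    (b : ℝ) : HasSum (fun n => w n * (Q.cost d n - b)) (η - b) := by
  have := hη.sub (hw.hasSum.mul_right b)
  simpa only [mul_sub, one_mul] using this

theorem SolvesPoisson.hasSum_tail (hG : Q.SolvesPoisson d η G) (hd : Q.IsEfficient d)
    (hw : Q.IsStationary d w) (hη : HasSum (fun n => w n * Q.cost d n) η) (n : ℕ) :
    HasSum (fun j => w (j + (n + 1)) * (Q.cost d (j + (n + 1)) - η)) (Q.lam * w n * G (n + 1)) := by
  have h := hasSum_cost_sub hw hη η
  rw [sub_self] at h
  have h2 := (hasSum_nat_add_iff' (n + 1)).2 h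
  rwa [zero_sub, ← hG.lam_mul_eq hd hw] at h2

theorem SolvesPoisson.tendsto_atTop (hG : Q.SolvesPoisson d η G) (hd : Q.IsEfficient d)
    (hw : Q.IsStationary d w) (hr : ∀ n, 0 < Q.rate d (n + 1))
    (hη : HasSum (fun n => w n * Q.cost d n) η) : Tendsto G atTop atTop := by
  set S := ∑ k, (Q.M k : ℝ) * Q.mu k with hS
  have hS0 : 0 < S := (hr 0).trans_le (hd.rate_le 1)
  rw [← tendsto_add_atTop_iff_nat 1]
  have h1 : Tendsto (fun n => (Q.h (n + 1) - η) / S) atTop atTop :=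
    (tendsto_atTop_add_const_right _ _
      (Q.h_tendsto.comp (tendsto_add_atTop_nat 1))).atTop_div_const hS0
  refine tendsto_atTop_mono' _ ?_ h1
  filter_upwards [(Q.h_tendsto.comp (tendsto_add_atTop_nat 1)).eventually_ge_atTop η] with n hn
  have hn' : η ≤ Q.h (n + 1) := hn
  have hw0 := hw.pos hr
  have h2 := le_hasSum (hG.hasSum_tail hd hw hη n) 0 fun j _ => by
    refine mul_nonneg (hw.nonneg _) (sub_nonneg.2 (hn'.trans ((Q.h_mono ?_).trans
      (Q.h_le_cost d _))))
    omega
  rw [hw.balance n, zero_add, mul_right_comm, mul_comm] at h2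
  have h3 := le_of_mul_le_mul_right h2 (hw0 (n + 1))
  have h4 := Q.h_le_cost d (n + 1)
  have hG0 : 0 ≤ G (n + 1) := by
    by_contra! hneg
    have := mul_neg_of_pos_of_neg (hr n) hneg
    linarith
  rw [div_le_iff₀ hS0, mul_comm]
  have := mul_le_mul_of_nonneg_right (hd.rate_le (n + 1)) hG0
  linarith

/-- The stationary distribution of a policy that eventually uses all servers decays fastest. -/
theorem IsStationary.cross_le {d' : ℕ → Fin K → ℕ} {w' : ℕ → ℝ} (hd' : Q.IsEfficient d')
    (hw : Q.IsStationary d w) (hw' : Q.IsStationary d' w') {N : ℕ}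
    (hfull : ∀ n, N ≤ n → Q.rate d n = ∑ k, (Q.M k : ℝ) * Q.mu k)
    {n : ℕ} (hn : N ≤ n) (j : ℕ) : w' n * w (j + n) ≤ w n * w' (j + n) := by
  set S := ∑ k, (Q.M k : ℝ) * Q.mu k with hS
  induction j with
  | zero => rw [zero_add, mul_comm]
  | succ j ih =>
    have hS0 : 0 ≤ S :=
      Finset.sum_nonneg fun k _ => mul_nonneg (Nat.cast_nonneg _) (Q.mu_pos k).le
    have h1 := hw.balance (j + n)
    rw [hfull (j + n + 1) (by omega)] at h1
    have h2 := hw'.balance (j + n)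
    have h3 := mul_le_mul_of_nonneg_right (hd'.rate_le (j + n + 1)) (hw'.nonneg (j + n + 1))
    rw [← h2] at h3
    rw [show j + 1 + n = j + n + 1 by omega]
    rcases hS0.eq_or_lt with h0 | h0
    · rw [← hS, ← h0, zero_mul] at h3
      rw [← h0, zero_mul] at h1
      have hz : w' n = 0 :=
        hw'.eq_zero_of_succ (n := j + n) (by
          rw [← h2]; exact le_antisymm h3 (mul_nonneg Q.lam_pos.le (hw'.nonneg _))) (by omega)
      rw [hz, zero_mul]
      exact mul_nonneg (hw.nonneg _) (hw'.nonneg _)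
    · refine le_of_mul_le_mul_left ?_ h0
      calc S * (w' n * w (j + n + 1)) = Q.lam * (w' n * w (j + n)) := by
            linear_combination -(w' n) * h1
        _ ≤ Q.lam * (w n * w' (j + n)) := mul_le_mul_of_nonneg_left ih Q.lam_pos.le
        _ ≤ S * (w n * w' (j + n + 1)) := by
            have := mul_le_mul_of_nonneg_left h3 (hw.nonneg n)
            linarith

theorem summable_holding {d' : ℕ → Fin K → ℕ} (hw : Q.IsStationary d' w)
    (hs : Summable fun n => w n * Q.cost d' n) : Summable fun n => w n * Q.h n := by
  have h0 := (hw.hasSum.mul_right (Q.h 0)).summable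
  have h1 : Summable fun n => w n * (Q.h n - Q.h 0) := by
    refine Summable.of_nonneg_of_le
      (fun n => mul_nonneg (hw.nonneg n) (sub_nonneg.2 (Q.h_mono (Nat.zero_le n))))
      (fun n => mul_le_mul_of_nonneg_left (sub_le_sub_right (Q.h_le_cost d' n) _) (hw.nonneg n)) ?_
    simpa only [mul_sub] using hs.sub h0
  refine (h1.add h0).congr fun n => ?_
  ring

/-- A policy that obeys the `c/μ`-rule with respect to its own potential is optimal. -/
theorem isOptimal_of_obeysRule (hQ : Q.ScaleEconomies) (hd : Q.IsEfficient d)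
    (hg : Q.IsPotential d g) (hrule : ∀ n, Q.ObeysRule n (prf g n) (d n)) : Q.IsOptimal d := by
  obtain ⟨η, hη, -⟩ := id hg
  have hG := hg.solvesPoisson hd hη
  set G := prf g
  obtain ⟨w, hw, hws, -⟩ := exists_isStationary hd hη
  obtain ⟨k₁, hk₁, hfirst, hmin⟩ := hQ.exists_first hd hw
  have hGκ := hG.lt_of_obeysRule hd hw hrule hmin
  have hr : ∀ n, 0 < Q.rate d (n + 1) := fun n =>
    rate_pos_of_pos ((hrule (n + 1)).pos (hd (n + 1)).1 hk₁ hfirst (hGκ n))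
  have hws' : HasSum (fun n => w n * Q.cost d n) η := by
    have := hη.unique (hw.hasAverageCost hd hr hws.hasSum)
    rw [this]; exact hws.hasSum
  have htop := hG.tendsto_atTop hd hw hr hws'
  have hev : ∀ᶠ n in atTop, (∀ k, Q.c k / Q.mu k < G n) ∧ ∑ k, Q.M k ≤ n ∧ η ≤ Q.h n :=
    (eventually_all.2 fun k => htop.eventually_gt_atTop _).and
      ((eventually_ge_atTop _).and (Q.h_tendsto.eventually_ge_atTop η))
  obtain ⟨N, hN⟩ := eventually_atTop.1 hev
  have hM : ∀ n, N ≤ n → d n = Q.M := fun n hn => funext fun k =>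
    (hrule n).eq_of_le (hd n).1 (hN n hn).2.1 (hN n hn).1 k
  have hfull : ∀ n, N ≤ n → Q.rate d n = ∑ k, (Q.M k : ℝ) * Q.mu k := fun n hn => by
    rw [rate, hM n hn]
  set C := ∑ k, (Q.M k : ℝ) * Q.c k with hC
  have hcost : ∀ n, N ≤ n → Q.cost d n = Q.h n + C := fun n hn => by rw [cost, hM n hn]
  refine ⟨hd, η, hη, fun d' η' hd' hη' => ?_⟩
  obtain ⟨w', hw', hs', hle'⟩ := exists_isStationary hd' hη'
  have hsum : ∀ n, 0 ≤ ∑ i ∈ Finset.range (n + 1), w' i * (Q.cost d' i - η)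
      + Q.lam * w' n * G (n + 1) := by
    intro n
    rw [hG.sum_eq hd' hw' n]
    exact Finset.sum_nonneg fun i _ => mul_nonneg (hw'.nonneg i) <|
      sub_nonneg.2 ((hrule i).net_le hQ (hd i).2 (hd' i).1 (hd' i).2)
  have hu : Summable fun n => w' n * (Q.h n + C - η) := by
    have := (summable_holding hw' hs').add (hw'.hasSum.mul_right (C - η)).summable
    refine this.congr fun n => ?_
    ring
  have hbd : ∀ n, N ≤ n → Q.lam * w' n * G (n + 1)
      ≤ ∑' j, w' (j + (n + 1)) * (Q.h (j + (n + 1)) + C - η) := by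
    intro n hn
    have hwn := hw.pos hr n
    have h1 := (hG.hasSum_tail hd hw hws' n).mul_left (w' n)
    have h2 := ((summable_nat_add_iff (n + 1)).2 hu).hasSum.mul_left (w n)
    have h3 := hasSum_le (fun j => ?_) h1 h2
    · refine le_of_mul_le_mul_left ?_ hwn
      linarith
    · have hx := hw.cross_le hd' hw' hfull hn (j + 1)
      rw [show j + 1 + n = j + (n + 1) by omega] at hx
      rw [hcost _ (by omega), ← mul_assoc, ← mul_assoc]
      refine mul_le_mul_of_nonneg_right hx ?_
      rw [← hcost _ (by omega)]
      exact sub_nonneg.2 ((hN _ (by omega)).2.2.trans (Q.h_le_cost d _))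
  have htail : Tendsto (fun n => ∑' j, w' (j + (n + 1)) * (Q.h (j + (n + 1)) + C - η))
      atTop (𝓝 0) :=
    (tendsto_sum_nat_add fun n => w' n * (Q.h n + C - η)).comp (tendsto_add_atTop_nat 1)
  have hpart := (hasSum_cost_sub hw' hs'.hasSum η).tendsto_sum_nat.comp (tendsto_add_atTop_nat 1)
  have hlim := ge_of_tendsto (hpart.add htail) (b := 0) <| by
    filter_upwards [eventually_ge_atTop N] with n hn
    exact (hsum n).trans (add_le_add le_rfl (hbd n hn))
  linarith

end GroupServerQueue

namespace GroupServerQueue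

variable {K : ℕ} {Q : GroupServerQueue K} {d d' : ℕ → Fin K → ℕ} {w g G : ℕ → ℝ} {η : ℝ}

/-- An irreducible policy that agrees with `d` above `N` has a stationary distribution that is
proportional to the one of `d` there; its mean cost is an average cost. -/
theorem IsStationary.exists_of_eq_above (hw : Q.IsStationary d w)
    (hs : Summable fun n => w n * Q.cost d n) (hd' : Q.IsEfficient d')
    (hr' : ∀ n, 0 < Q.rate d' (n + 1)) {N : ℕ} (heq : ∀ n, N < n → d' n = d n) :
    ∃ w', ∃ C > 0, Q.IsStationary d' w' ∧ (∀ n, N ≤ n → w' n = C * w n) ∧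
      Summable (fun n => w' n * Q.cost d' n) ∧
      Q.HasAverageCost d' (∑' n, w' n * Q.cost d' n) := by
  have hrate : ∀ n, N < n → Q.rate d' n = Q.rate d n := fun n hn => by rw [rate, rate, heq n hn]
  have hcost : ∀ n, N < n → Q.cost d' n = Q.cost d n := fun n hn => by rw [cost, cost, heq n hn]
  have hwN : ∀ n, N ≤ n → 0 < w n := fun n hn =>
    hw.pos_of_le (fun n hn => by rw [← hrate _ (by omega)]; exact hr' n) hn
  set v : ℕ → ℝ := fun n => ∏ i ∈ Finset.range n, Q.lam / Q.rate d' (i + 1) with hv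
  have hv0 : ∀ n, 0 < v n := fun n => Finset.prod_pos fun i _ => div_pos Q.lam_pos (hr' i)
  have hvb : ∀ n, Q.lam * v n = Q.rate d' (n + 1) * v (n + 1) := by
    intro n
    have := (hr' n).ne'
    simp only [hv]
    rw [Finset.prod_range_succ]
    field_simp
  have hvw : ∀ n, N ≤ n → v n = v N / w N * w n := by
    intro n hn
    induction hn with
    | refl => rw [div_mul_cancel₀ _ (hwN N le_rfl).ne']
    | @step n hn ih =>
      have h1 := hvb n
      have hn' : N < n + 1 := Nat.lt_succ_of_le hn
      rw [ih, mul_left_comm, hw.balance n, hrate (n + 1) hn', mul_left_comm] at h1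
      have h2 := hr' n
      rw [hrate _ hn'] at h2
      exact (mul_left_cancel₀ h2.ne' h1).symm
  set A := v N / w N with hA
  have hA0 : 0 < A := div_pos (hv0 N) (hwN N le_rfl)
  have hvs : Summable v := by
    rw [← summable_nat_add_iff N]
    refine (((summable_nat_add_iff N).2 hw.hasSum.summable).mul_left A).congr fun n => ?_
    exact (hvw _ (by omega)).symm
  set Z := ∑' n, v n with hZ
  have hZ0 : 0 < Z := hvs.tsum_pos (fun n => (hv0 n).le) 0 (hv0 0)
  have hw' : Q.IsStationary d' fun n => v n / Z :=
    { nonneg := fun n => (div_pos (hv0 n) hZ0).le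
      hasSum := by
        have := hvs.hasSum.div_const Z
        rwa [← hZ, div_self hZ0.ne'] at this
      balance := fun n => by rw [← mul_div_assoc, ← mul_div_assoc, hvb n] }
  have hws : Summable fun n => v n / Z * Q.cost d' n := by
    rw [← summable_nat_add_iff (N + 1)]
    refine (((summable_nat_add_iff (N + 1)).2 hs).mul_left (A / Z)).congr fun n => ?_
    rw [hcost _ (by omega), hvw _ (by omega)]
    ring
  exact ⟨fun n => v n / Z, A / Z, div_pos hA0 hZ0, hw', fun n hn => by
    simp only [hvw n hn]; ring, hws, hw'.hasAverageCost hd' hr' hws.hasSum⟩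

theorem IsStationary.hasSum_rate (hd : Q.IsEfficient d) (hw : Q.IsStationary d w) :
    HasSum (fun n => w n * Q.rate d n) Q.lam := by
  rw [← hasSum_nat_add_iff' 1]
  have h := hw.hasSum.mul_left Q.lam
  simp only [Finset.range_one, Finset.sum_singleton, hd.rate_zero, mul_zero, sub_zero]
  rw [mul_one] at h
  simpa only [hw.balance, mul_comm] using h

theorem IsStationary.sum_rate_sub (hd : Q.IsEfficient d) (hw : Q.IsStationary d w) (n : ℕ) :
    ∑ i ∈ Finset.range (n + 1), w i * (Q.rate d i - Q.lam) = -(Q.lam * w n) := by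
  induction n with
  | zero => simp [hd.rate_zero, mul_comm]
  | succ n ih =>
    rw [Finset.sum_range_succ, ih]
    linear_combination -hw.balance n

/-- Cost rate minus the value of the service provided at price `κ`. -/
noncomputable def reducedCost (Q : GroupServerQueue K) (d : ℕ → Fin K → ℕ) (κ : ℝ) (n : ℕ) : ℝ :=
  Q.cost d n - κ * Q.rate d n

theorem reducedCost_eq (Q : GroupServerQueue K) (d : ℕ → Fin K → ℕ) (κ : ℝ) (n : ℕ) :
    Q.reducedCost d κ n = Q.h n - Q.net (d n) κ := by
  rw [reducedCost, Q.cost_eq d n κ]; ring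

theorem h_le_reducedCost (hd : Q.IsEfficient d) {κ : ℝ}
    (hκ : ∀ l, 0 < Q.M l → κ ≤ Q.c l / Q.mu l) (n : ℕ) : Q.h n ≤ Q.reducedCost d κ n := by
  rw [reducedCost_eq, le_sub_self_iff]
  refine Finset.sum_nonpos fun k _ => ?_
  rcases Nat.eq_zero_or_pos (d n k) with h | h
  · rw [h]; simp
  · refine mul_nonpos_of_nonneg_of_nonpos (Nat.cast_nonneg _) (not_lt.1 fun h' => ?_)
    exact absurd (hκ k (h.trans_le ((hd n).1 k))) (not_le.2 ((Q.reward_pos_iff k κ).1 h'))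

theorem IsStationary.hasSum_reducedCost_sub (hd : Q.IsEfficient d) (hw : Q.IsStationary d w)
    {θ : ℝ} (hθ : HasSum (fun n => w n * Q.cost d n) θ) (κ b : ℝ) :
    HasSum (fun n => w n * (Q.reducedCost d κ n - (b - Q.lam * κ))) (θ - b) := by
  have h := (hθ.sub ((hw.hasSum_rate hd).mul_left κ)).sub (hw.hasSum.mul_right (b - Q.lam * κ))
  have e : θ - κ * Q.lam - 1 * (b - Q.lam * κ) = θ - b := by ring
  rw [e] at h
  have e2 : (fun n => w n * (Q.reducedCost d κ n - (b - Q.lam * κ)))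
      = fun n => w n * Q.cost d n - κ * (w n * Q.rate d n) - w n * (b - Q.lam * κ) := by
    ext n; rw [reducedCost]; ring
  rw [e2]
  exact h

/-- The average cost `η` is a lower bound of the average costs of all policies. -/
def IsLowerCost (Q : GroupServerQueue K) (η : ℝ) : Prop :=
  ∀ d' η', Q.IsEfficient d' → Q.HasAverageCost d' η' → η ≤ η'

/-- Above any level, an optimal policy is more costly than on average: otherwise a single
cheapest server below that level would be an improvement. -/
theorem IsLowerCost.tail_pos (hη : Q.IsLowerCost η) (hd : Q.IsEfficient d)
    (hw : Q.IsStationary d w) (hs : Summable fun n => w n * Q.cost d n) {N : ℕ}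
    (hr : ∀ n, N < n → 0 < Q.rate d (n + 1)) {k : Fin K} (hk : 0 < Q.M k)
    (hκ : ∀ l, 0 < Q.M l → Q.c k / Q.mu k ≤ Q.c l / Q.mu l) :
    0 < ∑' i, w (i + (N + 1)) * (Q.reducedCost d (Q.c k / Q.mu k) (i + (N + 1))
      - (η - Q.lam * (Q.c k / Q.mu k))) := by
  set κ := Q.c k / Q.mu k with hκdef
  set θ := η - Q.lam * κ with hθ
  have hsum : HasSum (fun n => w n * (Q.reducedCost d κ n - θ)) _ :=
    hw.hasSum_reducedCost_sub hd hs.hasSum κ η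
  have hsum' : Summable fun i => w (i + (N + 1)) * (Q.reducedCost d κ (i + (N + 1)) - θ) :=
    (summable_nat_add_iff (f := fun n => w n * (Q.reducedCost d κ n - θ)) (N + 1)).2 hsum.summable
  have hwN : ∀ n, N < n → 0 < w n := fun n hn => hw.pos_of_le (N := N + 1) (fun n hn => hr n hn) hn
  by_contra! hX
  have hlt : Q.h (N + 1) < θ := by
    by_contra! hle
    obtain ⟨m, hm⟩ := (Q.h_tendsto.eventually_gt_atTop θ).exists_forall_of_atTop
    have hnn : ∀ i, 0 ≤ w (i + (N + 1)) * (Q.reducedCost d κ (i + (N + 1)) - θ) := fun i =>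
      mul_nonneg (hw.nonneg _) (sub_nonneg.2 (hle.trans ((Q.h_mono (by omega)).trans
        (h_le_reducedCost hd hκ _))))
    refine absurd (hsum'.tsum_pos hnn m (mul_pos (hwN _ (by omega)) (sub_pos.2 ?_))) (not_lt.2 hX)
    exact (hm _ (by omega)).trans_le (h_le_reducedCost hd hκ _)
  set d' : ℕ → Fin K → ℕ := fun n =>
    if n = 0 then 0 else if n ≤ N + 1 then Pi.single k 1 else d n with hd'def
  have hd'low : ∀ n, n + 1 ≤ N + 1 → d' (n + 1) = Pi.single k 1 := fun n hn => by
    simp only [hd'def]; rw [if_neg (by omega), if_pos hn]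
  have hd'high : ∀ n, N + 1 < n → d' n = d n := fun n hn => by
    simp only [hd'def]; rw [if_neg (by omega), if_neg (by omega)]
  have hd' : Q.IsEfficient d' := by
    intro n
    rcases n with _ | n
    · simp [hd'def]
    · rcases le_or_gt (n + 1) (N + 1) with h | h
      · rw [hd'low n h]
        refine ⟨fun l => ?_, ?_⟩
        · rw [Pi.single_apply]; split_ifs with hl
          · rw [hl]; exact hk
          · exact Nat.zero_le _
        · simp
      · rw [hd'high _ h]; exact hd _
  have hr' : ∀ n, 0 < Q.rate d' (n + 1) := by
    intro n
    rcases le_or_gt (n + 1) (N + 1) with h | h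
    · refine rate_pos_of_pos (k := k) ?_
      rw [hd'low n h]; simp
    · have := hr n (by omega)
      rw [rate] at this ⊢
      rwa [hd'high _ h]
  have hred : ∀ n, n ≤ N + 1 → Q.reducedCost d' κ n = Q.h n := by
    intro n hn
    rw [reducedCost_eq, sub_eq_self, net]
    rcases n with _ | n
    · simp [hd'def]
    · rw [hd'low n hn]
      refine Finset.sum_eq_zero fun l _ => ?_
      rw [Pi.single_apply]; split_ifs with hl
      · rw [hl, reward_eq, ← hκdef]; simp
      · simp
  obtain ⟨w', C, hC, hw', hww', hs', havg⟩ := hw.exists_of_eq_above hs hd' hr' hd'high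
  have hopt := hη d' _ hd' havg
  have hsum2 : HasSum (fun n => w' n * (Q.reducedCost d' κ n - θ)) _ :=
    hw'.hasSum_reducedCost_sub hd' hs'.hasSum κ η
  have hsum2' : Summable fun i => w' (i + (N + 1)) * (Q.reducedCost d' κ (i + (N + 1)) - θ) :=
    (summable_nat_add_iff (f := fun n => w' n * (Q.reducedCost d' κ n - θ)) (N + 1)).2
      hsum2.summable
  have hsplit := hsum2.summable.sum_add_tsum_nat_add (N + 1)
  rw [hsum2.tsum_eq] at hsplit
  have hA : ∑ i ∈ Finset.range (N + 1), w' i * (Q.reducedCost d' κ i - θ) < 0 := by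
    refine Finset.sum_neg (fun i hi => ?_) ⟨0, by simp⟩
    rw [Finset.mem_range] at hi
    rw [hred i hi.le]
    refine mul_neg_of_pos_of_neg (hw'.pos hr' i) (sub_neg.2 ?_)
    exact (Q.h_mono hi.le).trans_lt hlt
  have hB : ∑' i, w' (i + (N + 1)) * (Q.reducedCost d' κ (i + (N + 1)) - θ)
      ≤ C * ∑' i, w (i + (N + 1)) * (Q.reducedCost d κ (i + (N + 1)) - θ) := by
    rw [← tsum_mul_left]
    refine Summable.tsum_le_tsum (fun i => ?_) hsum2' (hsum'.mul_left C)
    have hle : Q.reducedCost d' κ (i + (N + 1)) ≤ Q.reducedCost d κ (i + (N + 1)) := by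
      rcases Nat.eq_zero_or_pos i with hi | hi
      · rw [hred _ (by omega)]; exact h_le_reducedCost hd hκ _
      · rw [reducedCost_eq, reducedCost_eq, hd'high _ (by omega)]
    rw [hww' (i + (N + 1)) (by omega), mul_assoc]
    exact mul_le_mul_of_nonneg_left
      (mul_le_mul_of_nonneg_left (sub_le_sub_right hle θ) (hw.nonneg (i + (N + 1)))) hC.le
  have := mul_nonpos_of_nonneg_of_nonpos hC.le hX
  linarith

/-- An optimal policy is irreducible. -/
theorem IsLowerCost.rate_pos (hη : Q.IsLowerCost η) (hd : Q.IsEfficient d)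
    (hw : Q.IsStationary d w) (hs : Summable fun n => w n * Q.cost d n)
    (hle : ∑' n, w n * Q.cost d n ≤ η) {k : Fin K} (hk : 0 < Q.M k)
    (hκ : ∀ l, 0 < Q.M l → Q.c k / Q.mu k ≤ Q.c l / Q.mu l) (n : ℕ) :
    0 < Q.rate d (n + 1) := by
  have hz : ∀ n, Q.rate d (n + 1) = 0 → ∀ m ≤ n, w m = 0 := fun n h m hm =>
    hw.eq_zero_of_succ (by rw [h, zero_mul]) hm
  obtain ⟨N, hN⟩ := hw.exists_ne_zero
  have hlarge : ∀ n, N ≤ n → 0 < Q.rate d (n + 1) := fun n hn =>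
    (Q.rate_nonneg d _).lt_of_ne' fun h => hN (hz n h N hn)
  have hstep : ∀ N, (∀ n, N < n → 0 < Q.rate d (n + 1)) → 0 < Q.rate d (N + 1) := by
    intro N hr
    refine (Q.rate_nonneg d _).lt_of_ne' fun h => ?_
    have hpos := hη.tail_pos hd hw hs hr hk hκ
    have hsum := hw.hasSum_reducedCost_sub hd hs.hasSum (Q.c k / Q.mu k) η
    have hsplit := hsum.summable.sum_add_tsum_nat_add (N + 1)
    rw [hsum.tsum_eq, Finset.sum_eq_zero fun i hi => by
      rw [hz N h i (by rw [Finset.mem_range] at hi; omega), zero_mul]] at hsplit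
    linarith
  have hall : ∀ j, ∀ n, N ≤ n + j → 0 < Q.rate d (n + 1) := by
    intro j
    induction j with
    | zero => exact hlarge
    | succ j ih =>
      intro n hn
      exact hstep n fun m hm => ih m (by omega)
  exact hall N n (by omega)

/-- The realization factors of an optimal policy exceed the smallest `c/μ`. -/
theorem IsLowerCost.lt_factor (hη : Q.IsLowerCost η) (hd : Q.IsEfficient d)
    (hw : Q.IsStationary d w) (hr : ∀ n, 0 < Q.rate d (n + 1))
    (hsum : HasSum (fun n => w n * Q.cost d n) η) (hG : Q.SolvesPoisson d η G)
    {k : Fin K} (hk : 0 < Q.M k)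
    (hκ : ∀ l, 0 < Q.M l → Q.c k / Q.mu k ≤ Q.c l / Q.mu l) (n : ℕ) :
    Q.c k / Q.mu k < G (n + 1) := by
  have hpos := hη.tail_pos hd hw hsum.summable (N := n) (fun n _ => hr n) hk hκ
  set κ := Q.c k / Q.mu k
  have h1 := hw.hasSum_reducedCost_sub hd hsum κ η
  have hsplit := h1.summable.sum_add_tsum_nat_add (n + 1)
  rw [h1.tsum_eq] at hsplit
  have h2 : ∑ i ∈ Finset.range (n + 1), w i * (Q.reducedCost d κ i - (η - Q.lam * κ))
      = ∑ i ∈ Finset.range (n + 1), w i * (Q.cost d i - η)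
        - κ * ∑ i ∈ Finset.range (n + 1), w i * (Q.rate d i - Q.lam) := by
    rw [Finset.mul_sum, ← Finset.sum_sub_distrib]
    exact Finset.sum_congr rfl fun i _ => by rw [reducedCost]; ring
  rw [h2, hw.sum_rate_sub hd] at hsplit
  have h3 := hG.lam_mul_eq hd hw n
  have h4 : Q.lam * w n * κ < Q.lam * w n * G (n + 1) := by linarith
  exact lt_of_mul_lt_mul_left h4 (mul_pos Q.lam_pos (hw.pos hr n)).le

/-- The actions of an optimal policy are best responses to its realization factors. -/
theorem IsLowerCost.net_le (hη : Q.IsLowerCost η) (hd : Q.IsEfficient d)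
    (hw : Q.IsStationary d w) (hr : ∀ n, 0 < Q.rate d (n + 1))
    (hsum : HasSum (fun n => w n * Q.cost d n) η) (hG : Q.SolvesPoisson d η G)
    {n : ℕ} {a : Fin K → ℕ} (haM : ∀ k, a k ≤ Q.M k) (han : ∑ k, a k ≤ n)
    {k : Fin K} (hk : 0 < a k) : Q.net a (G n) ≤ Q.net (d n) (G n) := by
  set d' := Function.update d n a with hd'def
  have hself : d' n = a := Function.update_self _ _ _
  have hne : ∀ m, m ≠ n → d' m = d m := fun m hm => Function.update_of_ne hm _ _
  have hd' : Q.IsEfficient d' := by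
    intro m
    by_cases hm : m = n
    · rw [hm, hself]; exact ⟨haM, han⟩
    · rw [hne m hm]; exact hd m
  have hr' : ∀ m, 0 < Q.rate d' (m + 1) := by
    intro m
    by_cases hm : m + 1 = n
    · refine rate_pos_of_pos (k := k) ?_
      rwa [hm, hself]
    · have := hr m
      rw [rate] at this ⊢
      rwa [hne _ hm]
  obtain ⟨w', C, hC, hw', hww', hs', havg⟩ :=
    hw.exists_of_eq_above hsum.summable hd' hr' (N := n) fun m hm => hne m hm.ne'
  have hopt := hη d' _ hd' havg
  have hpart := (hasSum_cost_sub hw' hs'.hasSum η).tendsto_sum_nat.comp (tendsto_add_atTop_nat 1)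
  have hbdry : Tendsto (fun N => Q.lam * w' N * G (N + 1)) atTop (𝓝 0) := by
    have h1 := (hasSum_cost_sub hw hsum η).tendsto_sum_nat.comp (tendsto_add_atTop_nat 1)
    have h2 := h1.neg.const_mul C
    rw [sub_self, neg_zero, mul_zero] at h2
    refine h2.congr' ?_
    filter_upwards [eventually_ge_atTop n] with N hN
    have h3 := hG.lam_mul_eq hd hw N
    simp only [Function.comp]
    rw [hww' N hN, ← h3]
    ring
  have hval : Tendsto (fun N => ∑ i ∈ Finset.range (N + 1), w' i * (Q.cost d' i - η)
      + Q.lam * w' N * G (N + 1)) atTop (𝓝 (w' n * (Q.net (d n) (G n) - Q.net a (G n)))) := by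
    refine tendsto_const_nhds.congr' ?_
    filter_upwards [eventually_ge_atTop n] with N hN
    rw [hG.sum_eq hd' hw', Finset.sum_eq_single n]
    · rw [hself]
    · intro m _ hm
      rw [hne m hm, sub_self, mul_zero]
    · intro h
      exact absurd (Finset.mem_range.2 (by omega)) h
  have huniq := tendsto_nhds_unique hval (hpart.add hbdry)
  have h0 : 0 ≤ w' n * (Q.net (d n) (G n) - Q.net a (G n)) := by rw [huniq]; linarith
  exact sub_nonneg.1 (nonneg_of_mul_nonneg_right h0 (hw'.pos hr' n))

theorem net_eq_of_cast {a b : Fin K → ℕ} {k l : Fin K} {s t : ℝ} (x : ℝ)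
    (h : ∀ i, (a i : ℝ) = b i + (if i = k then s else 0) - (if i = l then t else 0)) :
    Q.net a x = Q.net b x + s * (Q.mu k * x - Q.c k) - t * (Q.mu l * x - Q.c l) := by
  simp only [net, h, sub_mul, add_mul, Finset.sum_sub_distrib, Finset.sum_add_distrib, ite_mul,
    zero_mul, Finset.sum_ite_eq', Finset.mem_univ, if_true]

/-- Best responses obey the `c/μ`-rule. -/
theorem ScaleEconomies.obeysRule (hQ : Q.ScaleEconomies) {n : ℕ} {x : ℝ} {b : Fin K → ℕ}
    (hbM : ∀ k, b k ≤ Q.M k) (hbn : ∑ k, b k ≤ n + 1)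
    (hbest : ∀ a : Fin K → ℕ, (∀ k, a k ≤ Q.M k) → ∑ k, a k ≤ n + 1 → ∀ k, 0 < a k →
      Q.net a x ≤ Q.net b x)
    {k₁ : Fin K} (hk₁ : 0 < Q.M k₁) (hfirst : ∀ l < k₁, Q.M l = 0)
    (hx : Q.c k₁ / Q.mu k₁ < x) : Q.ObeysRule (n + 1) x b := by
  have hgreedy : ∀ k, Q.c k / Q.mu k < x →
      b k = min (Q.M k) (n + 1 - ∑ l ∈ Finset.Iio k, b l) := by
    intro k hkx
    have hrk := (Q.reward_pos_iff k x).2 hkx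
    have hins : ∑ i ∈ insert k (Finset.Iio k), b i ≤ ∑ i, b i :=
      Finset.sum_le_sum_of_subset (Finset.subset_univ _)
    rw [Finset.sum_insert (by simp)] at hins
    have hM := hbM k
    by_contra hne
    have hlt : b k < Q.M k := by omega
    have hlt2 : b k + ∑ l ∈ Finset.Iio k, b l < n + 1 := by omega
    rcases hbn.lt_or_eq with hfree | hfull
    · set a : Fin K → ℕ := fun i => b i + if i = k then 1 else 0 with ha
      have h1 := hbest a (fun i => ?_) ?_ k (by simp [ha])
      · rw [net_eq_of_cast (b := b) (k := k) (l := k) (s := 1) (t := 0) x fun i => by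
          simp only [ha]; push_cast; simp] at h1
        linarith
      · simp only [ha]
        split_ifs with hi
        · rw [hi]; omega
        · exact hbM i
      · simp only [ha, Finset.sum_add_distrib, Finset.sum_ite_eq', Finset.mem_univ, if_true]
        omega
    · obtain ⟨l, hkl, hl⟩ : ∃ l, k < l ∧ 0 < b l := by
        by_contra! h
        have hsub : ∑ i ∈ insert k (Finset.Iio k), b i = ∑ i, b i := by
          refine Finset.sum_subset (Finset.subset_univ _) fun i _ hi => ?_
          simp only [Finset.mem_insert, Finset.mem_Iio, not_or, not_lt] at hi
          exact Nat.le_zero.1 (h i (lt_of_le_of_ne hi.2 (Ne.symm hi.1)))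
        rw [Finset.sum_insert (by simp)] at hsub
        omega
      set a : Fin K → ℕ := fun i => b i + (if i = k then 1 else 0) - if i = l then 1 else 0 with ha
      have hle : ∀ i, (if i = l then 1 else 0) ≤ b i + if i = k then 1 else 0 := fun i => by
        split_ifs with h1 <;> subst_vars <;> omega
      have hsum : ∑ i, a i + 1 = ∑ i, b i + 1 := by
        have e1 : ∑ i, (a i + if i = l then 1 else 0) = ∑ i, (b i + if i = k then 1 else 0) :=
          Finset.sum_congr rfl fun i _ => by simp only [ha]; exact Nat.sub_add_cancel (hle i)
        simpa [Finset.sum_add_distrib] using e1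
      have h1 := hbest a (fun i => ?_) (by omega) k (by simp [ha, hkl.ne])
      · rw [net_eq_of_cast (b := b) (k := k) (l := l) (s := 1) (t := 1) x fun i => by
          simp only [ha]; rw [Nat.cast_sub (hle i)]; push_cast; simp] at h1
        have := hQ.reward_lt hkl hrk
        linarith
      · have := hbM i
        simp only [ha]
        split_ifs with h1 h2 h2 <;> subst_vars <;> omega
  refine fun k => ⟨hgreedy k, fun hkx => ?_⟩
  by_contra hne
  have hrk := (Q.reward_neg_iff k x).2 hkx
  have hk₁b : 0 < b k₁ := by
    rw [hgreedy k₁ hx, Finset.sum_eq_zero fun l hl =>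
      Nat.le_zero.1 ((hbM l).trans_eq (hfirst l (Finset.mem_Iio.1 hl)))]
    omega
  have hkk : k₁ ≠ k := fun h => by rw [h] at hx; exact lt_asymm hx hkx
  set a : Fin K → ℕ := fun i => b i - if i = k then 1 else 0 with ha
  have hle : ∀ i, (if i = k then 1 else 0) ≤ b i := fun i => by
    split_ifs with h1 <;> subst_vars <;> omega
  have h1 := hbest a (fun i => (Nat.sub_le _ _).trans (hbM i))
    ((Finset.sum_le_sum fun i _ => Nat.sub_le _ _).trans hbn) k₁ (by simp [ha, hkk, hk₁b])
  rw [net_eq_of_cast (b := b) (k := k) (l := k) (s := 0) (t := 1) x fun i => by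
    simp only [ha]; rw [Nat.cast_sub (hle i)]; push_cast; simp] at h1
  linarith

/-- An optimal policy has a potential and obeys the `c/μ`-rule with respect to it. -/
theorem IsOptimal.exists_obeysRule (hQ : Q.ScaleEconomies) (hopt : Q.IsOptimal d) :
    ∃ g, Q.IsPotential d g ∧ ∀ n, Q.ObeysRule n (prf g n) (d n) := by
  obtain ⟨hd, η, hη, hlow⟩ := hopt
  replace hlow : Q.IsLowerCost η := hlow
  obtain ⟨w, hw, hs, hle⟩ := exists_isStationary hd hη
  obtain ⟨k₁, hk₁, hfirst, hmin⟩ := hQ.exists_first hd hw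
  have hr := hlow.rate_pos hd hw hs hle hk₁ hmin
  have hsum : HasSum (fun n => w n * Q.cost d n) η := by
    rw [hη.unique (hw.hasAverageCost hd hr hs.hasSum)]; exact hs.hasSum
  have hg := hw.isPotential hd hr hsum
  have hG := hg.solvesPoisson hd hη
  refine ⟨_, hg, fun n => ?_⟩
  rcases n with _ | n
  · exact fun k => ⟨fun _ => by rw [hd.zero k]; simp, fun _ => hd.zero k⟩
  · exact hQ.obeysRule (hd _).1 (hd _).2
      (fun a haM han k hk => hlow.net_le hd hw hr hsum hG haM han hk) hk₁ hfirst
      (hlow.lt_factor hd hw hr hsum hG hk₁ hmin n)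

theorem IsPotential.prf_eq {g' : ℕ → ℝ} (hg : Q.IsPotential d g) (hg' : Q.IsPotential d g') :
    prf g = prf g' := by
  obtain ⟨η, hη, h⟩ := hg
  obtain ⟨η', hη', h'⟩ := hg'
  obtain rfl := hη.unique hη'
  have heq : ∀ n, g n - g 0 = g' n - g' 0 := fun n => tendsto_nhds_unique (h n) (h' n)
  ext n
  simp only [prf]
  linarith [heq n, heq (n - 1)]

end GroupServerQueue

theorem theorem7 {K : ℕ} (Q : GroupServerQueue K) (hQ : Q.ScaleEconomies)
    (d : ℕ → Fin K → ℕ) (hd : Q.IsEfficient d) :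
    (Q.IsOptimal d ↔
      ∃ g, Q.IsPotential d g ∧ ∀ n k,
        (Q.c k / Q.mu k < prf g n →
          d n k = min (Q.M k) (n - ∑ l ∈ Finset.Iio k, d n l)) ∧
        (prf g n < Q.c k / Q.mu k → d n k = 0)) ∧
    (∀ g, Q.IsPotential d g → (∀ n k, prf g n = Q.c k / Q.mu k → d n k = 0) →
      (Q.IsOptimal d ↔ ∀ n k,
        (Q.c k / Q.mu k < prf g n →
          d n k = min (Q.M k) (n - ∑ l ∈ Finset.Iio k, d n l)) ∧
        (¬ Q.c k / Q.mu k < prf g n → d n k = 0))) := by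
  refine ⟨⟨fun h => h.exists_obeysRule hQ, fun ⟨g, hg, hrule⟩ =>
    GroupServerQueue.isOptimal_of_obeysRule hQ hd hg hrule⟩, fun g hg hoff => ⟨fun h => ?_,
    fun hrule => GroupServerQueue.isOptimal_of_obeysRule hQ hd hg fun n k =>
      ⟨(hrule n k).1, fun hlt => (hrule n k).2 (not_lt.2 hlt.le)⟩⟩⟩
  obtain ⟨g', hg', hrule⟩ := h.exists_obeysRule hQ
  rw [hg'.prf_eq hg] at hrule
  refine fun n k => ⟨(hrule n k).1, fun hnot => ?_⟩
  rcases (not_lt.1 hnot).lt_or_eq with h | h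
  · exact (hrule n k).2 h
  · exact hoff n k h
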